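/- Let $N \ge 1$ and $\gamma > 0$, and for $1 \le p < \infty$ let $$K_{N,p} = \int_{\mathbb{S}^{N-1}} |e\cdot\sigma|^p\, d\sigma,$$ where $e$ is any unit vector of $\mathbb{R}^N$. For $u \in L^1_{loc}(\mathbb{R}^N)$ (real-valued) and $\lambda > 0$ put $$\Phi_\lambda(u) = \lambda^p \iint_{\left\{(x,y)\,:\ \frac{|u(x)-u(y)|}{|x-y|^{1+\gamma/p}} > \lambda\right\}} |x-y|^{-N+\gamma}\,dx\,dy .$$ Let $\Phi(u)\in[0,\infty]$ be defined as follows. If $p>1$, then $\Phi(u) = \int_{\mathbb{R}^N} |\nabla u|^p\,dx$ if $u$ has a weak gradient $\nabla u \in L^1_{loc}(\mathbb{R}^N;\mathbb{R}^N)$, and $\Phi(u)=\infty$ otherwise. If $p=1$, then $\Phi(u)$ is the total variation of $u$, that is, the supremum of $\left|\int_{\mathbb{R}^N} u \operatorname{div}\varphi\,dx\right|$ over all $\varphi \in C_c^\infty(\mathbb{R}^N;\mathbb{R}^N)$ with $|\varphi|\le 1$ everywhere. 1. For every $1 \le p < \infty$ and every $u \in L^1_{loc}(\mathbb{R}^N)$,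 $$\frac{K_{N,p}}{\gamma+p}\,\Phi(u) \le \limsup_{\lambda\to+\infty} \Phi_\lambda(u).$$ In particular, if $u \in L^p(\mathbb{R}^N)$ and $\limsup_{\lambda\to+\infty} \Phi_\lambda(u) < \infty$, then $u \in W^{1,p}(\mathbb{R}^N)$ if $p>1$, and $u \in BV(\mathbb{R}^N)$ if $p=1$. 2. The constant is sharp for $p=1$: if $u$ is the characteristic function of a nonempty bounded convex open set with smooth boundary, then $0<\Phi(u)<\infty$ and $$\frac{K_{N,1}}{\gamma+1}\,\Phi(u) = \limsup_{\lambda\to+\infty}\Phi_\lambda(u).$$ -/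

import Mathlib

open MeasureTheory Filter Topology
open scoped ENNReal ContDiff

noncomputable section

namespace NonlocalBV

/-- The Euclidean space `ℝ^N`. -/
abbrev E (N : ℕ) : Type := EuclideanSpace ℝ (Fin N)

/-- The constant `K_{N,p} = ∫_{S^{N-1}} |e · σ|^p dσ`, where `e` is a unit vector and `dσ` is the
surface measure of the unit sphere (for `N = 1` the counting measure of `{-1, 1}`). -/
def sphereConst (N : ℕ) (p : ℝ) (e : E N) : ℝ :=
  ∫ σ : Metric.sphere (0 : E N) 1, |inner ℝ e (σ : E N)| ^ p
    ∂((volume : Measure (E N)).toSphere)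

/-- The divergence of a vector field on `ℝ^N`. -/
def divergence {N : ℕ} (φ : E N → E N) (x : E N) : ℝ :=
  ∑ i : Fin N, (fderiv ℝ φ x (EuclideanSpace.single i 1)) i

/-- The total variation `‖∇u‖_M`: the supremum of `|∫ u div φ|` over all `φ ∈ C_c^∞(ℝ^N; ℝ^N)`
with `|φ| ≤ 1` (possibly `∞`). -/
def totalVariation {N : ℕ} (u : E N → ℝ) : ℝ≥0∞ :=
  ⨆ φ ∈ {φ : E N → E N | ContDiff ℝ ∞ φ ∧ HasCompactSupport φ ∧ ∀ x, ‖φ x‖ ≤ 1},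
    ENNReal.ofReal |∫ x, u x * divergence φ x|

/-- `g ∈ L^1_loc(ℝ^N; ℝ^N)` is the weak (distributional) gradient of `u`. -/
def IsWeakGradient {N : ℕ} (u : E N → ℝ) (g : E N → E N) : Prop :=
  LocallyIntegrable g ∧
    ∀ φ : E N → ℝ, ContDiff ℝ ∞ φ → HasCompactSupport φ → ∀ i : Fin N,
      ∫ x, u x * fderiv ℝ φ x (EuclideanSpace.single i 1) = -∫ x, g x i * φ x

/-- The functional `Φ`, with values in `[0, ∞]`. For `p = 1` it is the total variation of `u`. For
`p > 1` it is `∫ |∇u|^p` if `u` has a weak gradient, and `∞` otherwise: the weak gradient is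
unique almost everywhere, so the infimum below has at most one distinct term. -/
def Phi {N : ℕ} (p : ℝ) (u : E N → ℝ) : ℝ≥0∞ :=
  if p = 1 then totalVariation u
  else ⨅ g ∈ {g : E N → E N | IsWeakGradient u g}, ∫⁻ x, ‖g x‖ₑ ^ p

/-- `u ∈ W^{1,p}(ℝ^N)`. -/
def MemSobolev {N : ℕ} (p : ℝ) (u : E N → ℝ) : Prop :=
  MemLp u (ENNReal.ofReal p) ∧ ∃ g : E N → E N, IsWeakGradient u g ∧ MemLp g (ENNReal.ofReal p)

/-- `u ∈ BV(ℝ^N)`. -/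
def MemBV {N : ℕ} (u : E N → ℝ) : Prop :=
  MemLp u 1 ∧ totalVariation u < ⊤

/-- The difference quotient `Q_b u (x, y) = (u x - u y) / |x - y|^{1+b}`. -/
def diffQuot {N : ℕ} (b : ℝ) (u : E N → ℝ) (z : E N × E N) : ℝ :=
  (u z.1 - u z.2) / ‖z.1 - z.2‖ ^ (1 + b)

/-- The set `E_{λ,b}(u)` of all `(x, y)` with `|Q_b u (x, y)| > λ`. -/
def superlevel {N : ℕ} (l b : ℝ) (u : E N → ℝ) : Set (E N × E N) :=
  {z | l < |diffQuot b u z|}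

/-- The measure `ν_γ` with density `|x - y|^{-N+γ}` on `ℝ^N × ℝ^N`. -/
def nu (N : ℕ) (γ : ℝ) : Measure (E N × E N) :=
  (volume : Measure (E N × E N)).withDensity
    fun z => ENNReal.ofReal (‖z.1 - z.2‖ ^ (-(N : ℝ) + γ))

/-- The nonlocal functional `Φ_λ(u) = λ^p ν_γ(E_{λ,γ/p}(u))`, where `l` stands for `λ`. -/
def PhiL {N : ℕ} (p γ : ℝ) (u : E N → ℝ) (l : ℝ) : ℝ≥0∞ :=
  ENNReal.ofReal (l ^ p) * nu N γ (superlevel l (γ / p) u)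

/-- The set `Ω` has smooth boundary: near each boundary point it is the set where some smooth
function with nonzero differential at that point is negative. -/
def HasSmoothBoundary {N : ℕ} (Ω : Set (E N)) : Prop :=
  ∀ x ∈ frontier Ω, ∃ U : Set (E N), IsOpen U ∧ x ∈ U ∧ ∃ f : E N → ℝ,
    ContDiffOn ℝ ∞ f U ∧ fderiv ℝ f x ≠ 0 ∧ Ω ∩ U = {y ∈ U | f y < 0}

end NonlocalBV

end

/-!
The functional `Φ_λ(u)` is a weak-type quantity: it measures the superlevel sets of the difference
quotient `Q u = |u(x) - u(y)| / |x - y|^{1+γ/p}` for the measure `ν_γ`. Both parts of the theorem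
compare it with energies
`∬ |u(x+h) - u(x)|^p |h|^{-N-p+δ}` over `|h| < 1`, whose product with `δ` tends, as `δ → 0`, to
`K ∫ |∇u|^p` for smooth `u` (the formula of Bourgain, Brezis and Mironescu).

**Lower bound.** Suppose first that `|u| ≤ M` and that `Φ_λ(u) ≤ A` for large `λ`. Since
`|u(x) - u(y)| ≤ 2M`, a small power `δ` of `|h|` is at most `(2M)^s` times the power `-s` of `Q u`,
where `s = δ p / (p + γ)`; so the energy with parameter `δ` is at most `(2M)^s ∫ |Q u|^{p-s} dν_γ`.
By the layer cake formula this is `A p / s` up to bounded terms, hence the product with `δ` has upper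
limit at most `(p + γ) A` (`energy_le_of_PhiL_le`, `limsup_energy_le`). This is where the constant
`γ + p` comes from. On the other side, the energies decrease under mollification by Jensen's
inequality (`energy_mollify_le`), and for a differentiable function the lower limit is at least
`K ∫ |∇v|^p`, by Fatou's lemma and polar coordinates (`le_liminf_energy`,
`lintegral_inner_rpow_ball_eq`). So the mollifications of `u` have gradients bounded in `L^p`;
truncation does not increase `Φ_λ`, which removes the bound on `u` (`gradient_mollify_bound`).

It remains to pass to the limit in the mollifications. For `p = 1` the total variation is lower
semicontinuous (`totalVariation_le_of_mollify`). For `p > 1` the distributional derivatives are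
bounded functionals for the `L^q` norm on test functions, `q` the dual exponent. They are extended
by the Hahn-Banach theorem to `L^q` of a finite measure, where the Radon-Nikodym theorem represents
them by integrable densities (`exists_density`); these form the weak gradient, and Fatou's lemma
bounds its norm (`exists_isWeakGradient`).

**Sharpness.** If `u` is a characteristic function, `Q u > λ` forces `|x - y| < λ^{-1/(1+γ)}` and
`|u(x) - u(y)| = 1`, so `Φ_λ(u)` is at most `λ` times the integral of
`‖u(· + h) - u‖_1 |h|^{-N+γ}` over that ball (`PhiL_indicator_le`). Mollifying, and integrating
the derivative along segments, bounds this by `K / (γ + 1)` times the total variation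
(`lintegral_radialWeight_translate_le`), for every `λ` and every measurable set. For a bounded convex
open set the total variation is finite: homothetic copies of the set with ratio close to `1` can be
translated inside it (`exists_lintegral_indicator_translate_le`), so `Φ_λ` is bounded, and the lower
bound applies.
-/

noncomputable section

namespace NonlocalBV

/-! ### Polar coordinates -/

/-- The radial weight `|h|^{-N+s}`; for `s = γ` it is the density of `nu N γ` in the variable
`h = x - y`. -/
def radialWeight (N : ℕ) (s : ℝ) (h : E N) : ℝ≥0∞ := ENNReal.ofReal (‖h‖ ^ (-(N : ℝ) + s))

@[fun_prop]
lemma measurable_radialWeight (N : ℕ) (s : ℝ) : Measurable (radialWeight N s) := by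
  unfold radialWeight; fun_prop

lemma lintegral_polar {N : ℕ} (hN : 1 ≤ N) (f : E N → ℝ≥0∞) (hf : Measurable f) :
    ∫⁻ h, f h = ∫⁻ σ : Metric.sphere (0 : E N) 1, (∫⁻ t in Set.Ioi (0 : ℝ),
      ENNReal.ofReal (t ^ (N - 1)) * f (t • (σ : E N))) ∂((volume : Measure (E N)).toSphere) := by
  have : Nonempty (Fin N) := ⟨⟨0, hN⟩⟩
  have hd : Module.finrank ℝ (E N) = N := by simp
  have h1 : ∫⁻ h, f h = ∫⁻ x : ({(0 : E N)}ᶜ : Set (E N)), f x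
      ∂((volume : Measure (E N)).comap Subtype.val) := by
    rw [lintegral_subtype_comap (measurableSet_singleton _).compl, restrict_compl_singleton]
  have h2 := ((volume : Measure (E N)).measurePreserving_homeomorphUnitSphereProd).lintegral_comp_emb
    (Homeomorph.measurableEmbedding _) (fun z => f (z.2.1 • z.1.1))
  have h3 : ∀ x : ({(0 : E N)}ᶜ : Set (E N)),
      f ((homeomorphUnitSphereProd (E N) x).2.1 • (homeomorphUnitSphereProd (E N) x).1.1) = f x := by
    intro x
    rw [← homeomorphUnitSphereProd_symm_apply_coe]; simp
  simp_rw [h3] at h2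
  rw [h1, h2, hd, lintegral_prod]
  · refine lintegral_congr fun σ => ?_
    rw [Measure.volumeIoiPow, lintegral_withDensity_eq_lintegral_mul _ (by fun_prop) (by fun_prop)]
    simp only [Pi.mul_apply]
    rw [lintegral_subtype_comap measurableSet_Ioi
      (fun t : ℝ => ENNReal.ofReal (t ^ (N - 1)) * f (t • σ.1))]
  · fun_prop

lemma lintegral_rpow_Ioo {s r : ℝ} (hs : 0 < s) (hr : 0 < r) :
    ∫⁻ t in Set.Ioo (0 : ℝ) r, ENNReal.ofReal (t ^ (s - 1)) = ENNReal.ofReal (r ^ s / s) := by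
  rw [Measure.restrict_congr_set Ioo_ae_eq_Ioc, ← ofReal_integral_eq_lintegral_ofReal,
    ← intervalIntegral.integral_of_le hr.le, integral_rpow (Or.inl (by linarith))]
  · simp [hs.ne']
  · exact (intervalIntegral.intervalIntegrable_rpow' (by linarith)).1
  · filter_upwards [ae_restrict_mem measurableSet_Ioc] with y hy
    exact Real.rpow_nonneg hy.1.le _

lemma sphere_integrand_integrable {N : ℕ} {p : ℝ} (hp : 0 ≤ p) (w : E N) :
    Integrable (fun σ : Metric.sphere (0 : E N) 1 => |inner ℝ w (σ : E N)| ^ p)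
      ((volume : Measure (E N)).toSphere) := by
  have hc : Continuous (fun σ : Metric.sphere (0 : E N) 1 => |inner ℝ w (σ : E N)| ^ p) :=
    Continuous.rpow_const (by fun_prop) fun _ => Or.inr hp
  exact hc.integrable_of_hasCompactSupport (HasCompactSupport.of_compactSpace _)

/-- The energy of the linear function `⟪w, ·⟫` on a ball: in polar coordinates the angular part is
the sphere constant and the radial part is `∫ t^{δ-1} dt` over `(0, r)`. -/
lemma lintegral_inner_rpow_ball {N : ℕ} (hN : 1 ≤ N) {p δ r : ℝ} (hp : 0 ≤ p) (hδ : 0 < δ)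
    (hr : 0 < r) (w : E N) :
    ∫⁻ h in Metric.ball (0 : E N) r, ‖inner ℝ w h‖ₑ ^ p * radialWeight N (δ - p) h
      = ENNReal.ofReal (sphereConst N p w * (r ^ δ / δ)) := by
  rw [← lintegral_indicator Metric.isOpen_ball.measurableSet, lintegral_polar hN]
  swap
  · exact (by fun_prop : Measurable fun h : E N =>
      ‖inner ℝ w h‖ₑ ^ p * radialWeight N (δ - p) h).indicator Metric.isOpen_ball.measurableSet
  have key : ∀ σ : Metric.sphere (0 : E N) 1, (∫⁻ t in Set.Ioi (0 : ℝ),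
      ENNReal.ofReal (t ^ (N - 1)) * (Metric.ball (0 : E N) r).indicator
        (fun h => ‖inner ℝ w h‖ₑ ^ p * radialWeight N (δ - p) h) (t • (σ : E N)))
      = ENNReal.ofReal (|inner ℝ w (σ : E N)| ^ p) * ENNReal.ofReal (r ^ δ / δ) := by
    intro σ
    have hσ : ‖(σ : E N)‖ = 1 := by simp
    rw [← lintegral_rpow_Ioo hδ hr, ← lintegral_const_mul _ (by fun_prop),
      ← lintegral_indicator measurableSet_Ioi, ← lintegral_indicator measurableSet_Ioo]
    refine lintegral_congr fun t => ?_
    by_cases ht : 0 < t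
    · by_cases htr : t < r
      · have hn : ‖t • (σ : E N)‖ = t := by rw [norm_smul, hσ, mul_one, Real.norm_of_nonneg ht.le]
        rw [Set.indicator_of_mem (show t ∈ Set.Ioi 0 from ht),
          Set.indicator_of_mem (show t ∈ Set.Ioo 0 r from ⟨ht, htr⟩),
          Set.indicator_of_mem (by simp [hn, htr])]
        rw [radialWeight, hn, real_inner_smul_right, Real.enorm_eq_ofReal_abs,
          ENNReal.ofReal_rpow_of_nonneg (abs_nonneg _) hp, ← ENNReal.ofReal_mul (by positivity),
          ← ENNReal.ofReal_mul (by positivity), ← ENNReal.ofReal_mul (by positivity)]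
        congr 1
        rw [abs_mul, abs_of_pos ht, Real.mul_rpow ht.le (abs_nonneg _)]
        have e1 : t ^ (N - 1) = t ^ ((N : ℝ) - 1) := by
          rw [← Real.rpow_natCast]; congr 1; push_cast [Nat.cast_sub hN]; ring
        have e2 : t ^ (δ - 1) = t ^ ((N : ℝ) - 1) * t ^ p * t ^ (-(N : ℝ) + (δ - p)) := by
          rw [← Real.rpow_add ht, ← Real.rpow_add ht]; congr 1; ring
        rw [e1, e2]; ring
      · have hn : ‖t • (σ : E N)‖ = t := by rw [norm_smul, hσ, mul_one, Real.norm_of_nonneg ht.le]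
        rw [Set.indicator_of_mem (show t ∈ Set.Ioi 0 from ht),
          Set.indicator_of_notMem (fun h => htr h.2 : t ∉ Set.Ioo 0 r),
          Set.indicator_of_notMem (by simpa [hn] using htr), mul_zero]
    · rw [Set.indicator_of_notMem (fun h => ht h : t ∉ Set.Ioi 0),
          Set.indicator_of_notMem (fun h => ht h.1 : t ∉ Set.Ioo 0 r)]
  simp_rw [key]
  rw [lintegral_mul_const _ (by fun_prop), ← ofReal_integral_eq_lintegral_ofReal
    (sphere_integrand_integrable hp w) (Eventually.of_forall fun _ => by positivity),
    ← ENNReal.ofReal_mul (integral_nonneg fun _ => by positivity)]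
  rfl

lemma sphereConst_nonneg (N : ℕ) (p : ℝ) (w : E N) : 0 ≤ sphereConst N p w :=
  integral_nonneg fun _ => by positivity

/-- The sphere constant does not depend on the unit vector: two unit vectors are exchanged by a
reflection, which preserves volume. -/
lemma sphereConst_eq {N : ℕ} (hN : 1 ≤ N) {p : ℝ} (hp : 0 ≤ p) {e w : E N} (he : ‖e‖ = 1)
    (hw : ‖w‖ = 1) : sphereConst N p w = sphereConst N p e := by
  set T : E N ≃ₗᵢ[ℝ] E N := (ℝ ∙ (w - e))ᗮ.reflection with hT
  have hTw : T w = e := Submodule.reflection_sub (by rw [hw, he])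
  have h1 := lintegral_inner_rpow_ball hN hp one_pos one_pos w
  have h2 := lintegral_inner_rpow_ball hN hp one_pos one_pos e
  rw [← lintegral_indicator Metric.isOpen_ball.measurableSet] at h1 h2
  have h3 := T.measurePreserving.lintegral_comp_emb T.toHomeomorph.measurableEmbedding
    ((Metric.ball (0 : E N) 1).indicator
      (fun h => ‖inner ℝ e h‖ₑ ^ p * radialWeight N (1 - p) h))
  have h4 : ∀ h, (Metric.ball (0 : E N) 1).indicator
      (fun h => ‖inner ℝ e h‖ₑ ^ p * radialWeight N (1 - p) h) (T h) =
      (Metric.ball (0 : E N) 1).indicator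
      (fun h => ‖inner ℝ w h‖ₑ ^ p * radialWeight N (1 - p) h) h := by
    intro h
    by_cases hh : h ∈ Metric.ball (0 : E N) 1
    · rw [Set.indicator_of_mem hh, Set.indicator_of_mem (by simpa using hh), radialWeight,
        radialWeight, T.norm_map, ← hTw, T.inner_map_map]
    · rw [Set.indicator_of_notMem hh, Set.indicator_of_notMem (by simpa using hh)]
  simp_rw [h4] at h3
  rw [h1, h2] at h3
  have := (ENNReal.ofReal_eq_ofReal_iff
    (mul_nonneg (sphereConst_nonneg _ _ _) (by norm_num))
    (mul_nonneg (sphereConst_nonneg _ _ _) (by norm_num))).1 h3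
  simpa using this

lemma sphereConst_smul (N : ℕ) (p : ℝ) (c : ℝ) (w : E N) :
    sphereConst N p (c • w) = |c| ^ p * sphereConst N p w := by
  unfold sphereConst
  rw [← integral_const_mul]
  refine integral_congr_ae (Eventually.of_forall fun σ => ?_)
  simp only [real_inner_smul_left, abs_mul]
  rw [Real.mul_rpow (abs_nonneg _) (abs_nonneg _)]

lemma sphereConst_eq_norm_rpow_mul {N : ℕ} (hN : 1 ≤ N) {p : ℝ} (hp : 0 < p) {e : E N}
    (he : ‖e‖ = 1) (w : E N) : sphereConst N p w = ‖w‖ ^ p * sphereConst N p e := by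
  by_cases hw : w = 0
  · simp [hw, sphereConst, Real.zero_rpow hp.ne']
  · have hn : ‖w‖ ≠ 0 := norm_ne_zero_iff.2 hw
    have h1 : ‖(‖w‖⁻¹ • w)‖ = 1 := by rw [norm_smul, norm_inv, norm_norm, inv_mul_cancel₀ hn]
    rw [← sphereConst_eq hN hp.le he h1]
    conv_lhs => rw [← smul_inv_smul₀ hn w]
    rw [sphereConst_smul, abs_norm]

lemma sphereConst_pos {N : ℕ} {p : ℝ} (hp : 0 ≤ p) {e : E N} (he : ‖e‖ = 1) :
    0 < sphereConst N p e := by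
  have hc : Continuous (fun σ : Metric.sphere (0 : E N) 1 => |inner ℝ e (σ : E N)| ^ p) :=
    Continuous.rpow_const (by fun_prop) fun _ => Or.inr hp
  refine hc.integral_pos_of_hasCompactSupport_nonneg_nonzero
    (HasCompactSupport.of_compactSpace _) (fun _ => by positivity) (x := ⟨e, by simp [he]⟩) ?_
  simp [he]

/-- `lintegral_inner_rpow_ball` with the constant of a fixed unit vector `e`, by homogeneity. -/
lemma lintegral_inner_rpow_ball_eq {N : ℕ} (hN : 1 ≤ N) {p δ r : ℝ} (hp : 0 < p) (hδ : 0 < δ)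
    (hr : 0 < r) {e : E N} (he : ‖e‖ = 1) (w : E N) :
    ∫⁻ h in Metric.ball (0 : E N) r, ‖inner ℝ w h‖ₑ ^ p * radialWeight N (δ - p) h
      = ENNReal.ofReal (sphereConst N p e) * ENNReal.ofReal (r ^ δ / δ) * ‖w‖ₑ ^ p := by
  rw [lintegral_inner_rpow_ball hN hp.le hδ hr, sphereConst_eq_norm_rpow_mul hN hp he w,
    ← ofReal_norm, ENNReal.ofReal_rpow_of_nonneg (norm_nonneg _) hp.le,
    ← ENNReal.ofReal_mul (sphereConst_nonneg _ _ _), ← ENNReal.ofReal_mul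
      (mul_nonneg (sphereConst_nonneg _ _ _) (by positivity))]
  congr 1; ring

lemma lintegral_radialWeight_ball {N : ℕ} (hN : 1 ≤ N) {δ r : ℝ} (hδ : 0 < δ) (hr : 0 < r)
    (e : E N) :
    ∫⁻ h in Metric.ball (0 : E N) r, radialWeight N δ h
      = ENNReal.ofReal (sphereConst N 0 e * (r ^ δ / δ)) := by
  simpa using lintegral_inner_rpow_ball hN le_rfl hδ hr e

/-! ### From superlevel sets to energies -/

lemma lintegral_Ioi_rpow_neg {s a : ℝ} (hs : 0 < s) (ha : 0 < a) :
    ∫⁻ t in Set.Ioi a, ENNReal.ofReal (t ^ (-s - 1)) = ENNReal.ofReal (a ^ (-s) / s) := by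
  rw [← ofReal_integral_eq_lintegral_ofReal, integral_Ioi_rpow_of_lt (by linarith) ha]
  · congr 1
    rw [sub_add_cancel, neg_div_neg_eq]
  · exact integrableOn_Ioi_rpow_of_lt (by linarith) ha
  · filter_upwards [ae_restrict_mem measurableSet_Ioi] with y hy
    exact Real.rpow_nonneg (ha.le.trans (le_of_lt hy)) _

/-- Layer cake for a function that satisfies a weak `L^p` bound above the level `Λ`. The levels below
`Λ` contribute the term with `μ S`, those above it a term of order `p / s`. -/
lemma lintegral_rpow_le_of_weak {α : Type*} [MeasurableSpace α] {μ : Measure α} {f : α → ℝ}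
    (hf : Measurable f) (hf0 : ∀ x, 0 ≤ f x) {p s Λ : ℝ} (hs : 0 < s) (hsp : s < p) (hΛ : 0 < Λ)
    {A : ℝ≥0∞} (hA : ∀ l, Λ ≤ l → ENNReal.ofReal (l ^ p) * μ {x | l < f x} ≤ A)
    {S : Set α} :
    ∫⁻ x in S, ENNReal.ofReal (f x ^ (p - s)) ∂μ
      ≤ ENNReal.ofReal (Λ ^ (p - s)) * μ S
        + ENNReal.ofReal ((p - s) / s * Λ ^ (-s)) * A := by
  have hq : 0 < p - s := sub_pos.2 hsp
  rw [lintegral_rpow_eq_lintegral_meas_lt_mul _ (Eventually.of_forall hf0) hf.aemeasurable hq]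
  have hsplit : Set.Ioi (0 : ℝ) ⊆ Set.Ioo 0 Λ ∪ Set.Ici Λ := fun t ht => by
    rcases lt_or_ge t Λ with h | h
    · exact Or.inl ⟨ht, h⟩
    · exact Or.inr h
  have h1 : ∫⁻ t in Set.Ioo 0 Λ, (μ.restrict S) {a | t < f a} * ENNReal.ofReal (t ^ (p - s - 1))
      ≤ μ S * ENNReal.ofReal (Λ ^ (p - s) / (p - s)) := by
    rw [← lintegral_rpow_Ioo hq hΛ, ← lintegral_const_mul _ (by fun_prop)]
    refine lintegral_mono fun t => ?_
    gcongr ?_ * _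
    exact (measure_mono (Set.subset_univ _)).trans_eq (Measure.restrict_apply_univ _)
  have h2 : ∫⁻ t in Set.Ici Λ, (μ.restrict S) {a | t < f a} * ENNReal.ofReal (t ^ (p - s - 1))
      ≤ A * ENNReal.ofReal (Λ ^ (-s) / s) := by
    rw [← lintegral_Ioi_rpow_neg hs hΛ, ← lintegral_const_mul _ (by fun_prop),
      Measure.restrict_congr_set Ioi_ae_eq_Ici.symm]
    refine setLIntegral_mono (by fun_prop) fun t ht => ?_
    have ht0 : 0 < t := hΛ.trans ht
    have hm : (μ.restrict S) {a | t < f a} ≤ μ {a | t < f a} := Measure.restrict_apply_le _ _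
    have e1 : t ^ (p - s - 1) = t ^ p * t ^ (-s - 1) := by
      rw [← Real.rpow_add ht0]; congr 1; ring
    calc _ ≤ μ {a | t < f a} * (ENNReal.ofReal (t ^ p) * ENNReal.ofReal (t ^ (-s - 1))) := by
          rw [e1, ENNReal.ofReal_mul (by positivity)]; gcongr
      _ = (ENNReal.ofReal (t ^ p) * μ {a | t < f a}) * ENNReal.ofReal (t ^ (-s - 1)) := by ring
      _ ≤ _ := by gcongr; exact hA t (le_of_lt ht)
  calc _ ≤ ENNReal.ofReal (p - s) * (μ S * ENNReal.ofReal (Λ ^ (p - s) / (p - s))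
        + A * ENNReal.ofReal (Λ ^ (-s) / s)) := by
        gcongr
        refine (lintegral_mono_set hsplit).trans ((lintegral_union_le _ _ _).trans ?_)
        gcongr
    _ = _ := by
        rw [mul_add, mul_left_comm, ← ENNReal.ofReal_mul hq.le, mul_left_comm,
          ← ENNReal.ofReal_mul hq.le, mul_comm, mul_comm A]
        congr 3
        · field_simp
        · ring

lemma measurable_diffQuot {N : ℕ} (b : ℝ) {u : E N → ℝ} (hu : Measurable u) :
    Measurable (diffQuot b u) := by
  unfold diffQuot; fun_prop

/-- For `|u| ≤ M` the power `|x - y|^δ` is at most `(2M)^s` times the power `-s` of the difference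
quotient, where `s = δ p / (p + γ)`. -/
lemma energy_density_le {N : ℕ} {u : E N → ℝ} {M p γ δ : ℝ} (hM : 0 < M)
    (hb : ∀ x, |u x| ≤ M) (hp : 1 ≤ p) (hγ : 0 < γ) (hδ : 0 < δ) (hδ' : δ < p + γ) (z : E N × E N) :
    ‖u z.1 - u z.2‖ₑ ^ p * radialWeight N (δ - p) (z.1 - z.2)
      ≤ ENNReal.ofReal ((2 * M) ^ (δ * p / (p + γ))) *
        (radialWeight N γ (z.1 - z.2) *
          ENNReal.ofReal (|diffQuot (γ / p) u z| ^ (p - δ * p / (p + γ)))) := by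
  set s := δ * p / (p + γ) with hs
  have hp0 : 0 < p := by linarith
  have hpg : 0 < p + γ := by linarith
  have hs0 : 0 < s := by positivity
  have hsp : s < p := by rw [hs, div_lt_iff₀ hpg]; nlinarith
  -- On the diagonal the weight is a junk value of `0 ^ _`, but the difference of `u` vanishes.
  by_cases hz : z.1 - z.2 = 0
  · rw [sub_eq_zero.1 hz]; simp [hp0]
  have ht : 0 < ‖z.1 - z.2‖ := norm_pos_iff.2 hz
  set t := ‖z.1 - z.2‖ with htdef
  rw [radialWeight, radialWeight, ← htdef, Real.enorm_eq_ofReal_abs,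
    ENNReal.ofReal_rpow_of_nonneg (abs_nonneg _) hp0.le, ← ENNReal.ofReal_mul (by positivity),
    ← ENNReal.ofReal_mul (by positivity), ← ENNReal.ofReal_mul (by positivity)]
  apply ENNReal.ofReal_le_ofReal
  rw [diffQuot, ← htdef, abs_div, abs_of_pos (Real.rpow_pos_of_pos ht _)]
  set d := |u z.1 - u z.2| with hd
  have hd0 : 0 ≤ d := abs_nonneg _
  have hdM : d ≤ 2 * M := by
    have h1 := abs_le.1 (hb z.1)
    have h2 := abs_le.1 (hb z.2)
    rw [hd, abs_le]; constructor <;> linarith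
  have e1 : d ^ p = d ^ s * d ^ (p - s) := by
    rw [← Real.rpow_add' hd0 (by linarith)]; congr 1; ring
  have e2 : (d / t ^ (1 + γ / p)) ^ (p - s) = d ^ (p - s) * t ^ (δ - p - γ) := by
    rw [Real.div_rpow hd0 (by positivity), ← Real.rpow_mul ht.le, div_eq_mul_inv,
      ← Real.rpow_neg ht.le]
    congr 2
    rw [hs]; field_simp; ring
  have e3 : t ^ (-(N : ℝ) + (δ - p)) = t ^ (-(N : ℝ) + γ) * t ^ (δ - p - γ) := by
    rw [← Real.rpow_add ht]; congr 1; ring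
  rw [e1, e2, e3]
  have : d ^ s ≤ (2 * M) ^ s := Real.rpow_le_rpow hd0 hdM hs0.le
  calc d ^ s * d ^ (p - s) * (t ^ (-(N : ℝ) + γ) * t ^ (δ - p - γ))
      ≤ (2 * M) ^ s * d ^ (p - s) * (t ^ (-(N : ℝ) + γ) * t ^ (δ - p - γ)) := by gcongr
    _ = _ := by ring

/-- A bound of `Φ_λ(u)` for all large `λ` bounds the energies with kernel `|h|^{-N-p+δ}`; as
`δ → 0`, the bound behaves like `(p + γ) A / δ`. -/
lemma energy_le_of_PhiL_le {N : ℕ} {u : E N → ℝ} (hu : Measurable u) {M p γ δ Λ : ℝ} (hM : 0 < M)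
    (hb : ∀ x, |u x| ≤ M) (hp : 1 ≤ p) (hγ : 0 < γ) (hδ : 0 < δ) (hδ' : δ < p + γ) (hΛ : 0 < Λ)
    {A : ℝ≥0∞} (hA : ∀ l, Λ ≤ l → PhiL p γ u l ≤ A) {S : Set (E N × E N)} (hS : MeasurableSet S) :
    ∫⁻ z in S, ‖u z.1 - u z.2‖ₑ ^ p * radialWeight N (δ - p) (z.1 - z.2)
      ≤ ENNReal.ofReal ((2 * M) ^ (δ * p / (p + γ))) *
        (ENNReal.ofReal (Λ ^ (p - δ * p / (p + γ))) * nu N γ S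
          + ENNReal.ofReal ((p - δ * p / (p + γ)) / (δ * p / (p + γ))
            * Λ ^ (-(δ * p / (p + γ)))) * A) := by
  have hpg : 0 < p + γ := by linarith
  have hQ := (measurable_diffQuot (γ / p) hu)
  refine (lintegral_mono (energy_density_le hM hb hp hγ hδ hδ')).trans ?_
  rw [lintegral_const_mul _ (by fun_prop)]
  gcongr
  have hw : Measurable fun z : E N × E N => radialWeight N γ (z.1 - z.2) := by fun_prop
  have h1 := lintegral_rpow_le_of_weak (μ := nu N γ) (f := fun z => |diffQuot (γ / p) u z|)
    (by fun_prop) (fun _ => abs_nonneg _) (p := p) (s := δ * p / (p + γ)) (Λ := Λ) (S := S) (A := A)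
    (by positivity) (by rw [div_lt_iff₀ hpg]; nlinarith) hΛ (fun l hl => hA l hl)
  refine le_trans (le_of_eq ?_) h1
  exact (setLIntegral_withDensity_eq_setLIntegral_mul _ hw (by fun_prop) hS).symm

/-! ### Mollification -/

/-- A bump function around the origin, supported in the ball of radius `1 / (n + 1)`. -/
def bump (N n : ℕ) : ContDiffBump (0 : E N) where
  rIn := 1 / (2 * ((n : ℝ) + 1))
  rOut := 1 / ((n : ℝ) + 1)
  rIn_pos := by positivity
  rIn_lt_rOut := by
    rw [one_div_lt_one_div (by positivity) (by positivity)]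
    have : (0 : ℝ) < n + 1 := by positivity
    linarith

/-- The mollifier of index `n`: a smooth probability density, supported in the ball of radius
`1 / (n + 1)`. -/
def mollifier (N n : ℕ) : E N → ℝ := (bump N n).normed volume

/-- The mollification of index `n` of a function on `ℝ^N`. -/
def mollify {N : ℕ} (n : ℕ) (u : E N → ℝ) : E N → ℝ :=
  convolution (mollifier N n) u (ContinuousLinearMap.lsmul ℝ ℝ) volume

section mollifier

variable {N : ℕ} (n : ℕ)

lemma mollifier_nonneg (x : E N) : 0 ≤ mollifier N n x := (bump N n).nonneg_normed x

lemma mollifier_contDiff : ContDiff ℝ ∞ (mollifier N n) := (bump N n).contDiff_normed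

lemma mollifier_continuous : Continuous (mollifier N n) := (mollifier_contDiff n).continuous

@[fun_prop]
lemma mollifier_measurable : Measurable (mollifier N n) := (mollifier_continuous n).measurable

lemma mollifier_hasCompactSupport : HasCompactSupport (mollifier N n) :=
  (bump N n).hasCompactSupport_normed

lemma integral_mollifier : ∫ x, mollifier N n x = 1 := (bump N n).integral_normed

lemma integrable_mollifier : Integrable (mollifier N n) := (bump N n).integrable_normed

lemma lintegral_mollifier : ∫⁻ x, ENNReal.ofReal (mollifier N n x) = 1 := by
  rw [← ofReal_integral_eq_lintegral_ofReal (integrable_mollifier n)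
    (Eventually.of_forall (mollifier_nonneg n)), integral_mollifier, ENNReal.ofReal_one]

lemma bump_rOut_tendsto (N : ℕ) : Tendsto (fun n => (bump N n).rOut) atTop (𝓝 0) :=
  tendsto_one_div_add_atTop_nhds_zero_nat

lemma norm_lt_of_mollifier_ne_zero {t : E N} (ht : mollifier N n t ≠ 0) : ‖t‖ < 1 := by
  have h1 : t ∈ Function.support (mollifier N n) := ht
  rw [mollifier, ContDiffBump.support_normed_eq] at h1
  have h2 : ‖t‖ < 1 / ((n : ℝ) + 1) := by simpa [bump] using h1
  refine h2.trans_le ?_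
  rw [div_le_one (by positivity)]
  have : (0 : ℝ) ≤ n := by positivity
  linarith

variable {u : E N → ℝ}

lemma mollify_apply (x : E N) : mollify n u x = ∫ t, mollifier N n t * u (x - t) := rfl

lemma mollify_apply_swap (x : E N) : mollify n u x = ∫ t, mollifier N n (x - t) * u t := by
  rw [mollify, convolution_lsmul_swap]; rfl

lemma integrable_mollifier_mul (hu : LocallyIntegrable u) (x : E N) :
    Integrable fun t => mollifier N n t * u (x - t) :=
  (mollifier_hasCompactSupport n).convolutionExists_left (ContinuousLinearMap.lsmul ℝ ℝ)
    (mollifier_continuous n) hu x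

lemma mollify_contDiff (hu : LocallyIntegrable u) : ContDiff ℝ ∞ (mollify n u) :=
  (mollifier_hasCompactSupport n).contDiff_convolution_left _ (mollifier_contDiff n) hu

lemma mollify_continuous (hu : LocallyIntegrable u) : Continuous (mollify n u) :=
  (mollify_contDiff n hu).continuous

lemma mollify_differentiable (hu : LocallyIntegrable u) : Differentiable ℝ (mollify n u) :=
  (mollify_contDiff n hu).differentiable (by simp)

lemma ae_tendsto_mollify (hu : LocallyIntegrable u) :
    ∀ᵐ x, Tendsto (fun n => mollify n u x) atTop (𝓝 (u x)) := by
  refine ContDiffBump.ae_convolution_tendsto_right_of_locallyIntegrable (bump_rOut_tendsto N)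
    (K := 2) (Eventually.of_forall fun n => le_of_eq ?_) hu
  simp only [bump]
  field_simp

/-- Jensen's inequality for the mollification of a difference. -/
lemma enorm_mollify_sub_rpow_le (hu : LocallyIntegrable u) (hm : Measurable u) {p : ℝ} (hp : 1 ≤ p)
    (x h : E N) :
    ‖mollify n u (x + h) - mollify n u x‖ₑ ^ p
      ≤ ∫⁻ t, ENNReal.ofReal (mollifier N n t) * ‖u (x - t + h) - u (x - t)‖ₑ ^ p := by
  set P : Measure (E N) := volume.withDensity fun t => ENNReal.ofReal (mollifier N n t) with hP
  have hPp : IsProbabilityMeasure P := ⟨by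
    rw [hP, withDensity_apply _ MeasurableSet.univ, Measure.restrict_univ, lintegral_mollifier]⟩
  have hp0 : 0 < p := by linarith
  set f : E N → ℝ := fun t => u (x - t + h) - u (x - t) with hf
  have hfm : Measurable f := by fun_prop
  have h1 : mollify n u (x + h) - mollify n u x = ∫ t, mollifier N n t * f t := by
    rw [mollify_apply, mollify_apply, ← integral_sub (integrable_mollifier_mul n hu _)
      (integrable_mollifier_mul n hu _)]
    refine integral_congr_ae (Eventually.of_forall fun t => ?_)
    simp only [hf]
    rw [show x + h - t = x - t + h by abel]; ring
  have h2 : ‖mollify n u (x + h) - mollify n u x‖ₑ ≤ ∫⁻ t, ‖f t‖ₑ ∂P := by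
    rw [h1, hP, lintegral_withDensity_eq_lintegral_mul _ (by fun_prop) (by fun_prop)]
    refine (enorm_integral_le_lintegral_enorm _).trans (lintegral_mono fun t => ?_)
    rw [enorm_mul, Real.enorm_of_nonneg (mollifier_nonneg n t)]; rfl
  have h3 := eLpNorm_le_eLpNorm_of_exponent_le (μ := P) (p := 1) (q := ENNReal.ofReal p)
    (by simpa using hp) hfm.aestronglyMeasurable
  rw [eLpNorm_one_eq_lintegral_enorm, eLpNorm_eq_lintegral_rpow_enorm_toReal
    (by simpa using hp0) ENNReal.ofReal_ne_top, ENNReal.toReal_ofReal hp0.le] at h3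
  calc _ ≤ ((∫⁻ t, ‖f t‖ₑ ^ p ∂P) ^ (1 / p)) ^ p := ENNReal.rpow_le_rpow (h2.trans h3) hp0.le
    _ = ∫⁻ t, ‖f t‖ₑ ^ p ∂P := by
      rw [← ENNReal.rpow_mul, one_div_mul_cancel hp0.ne', ENNReal.rpow_one]
    _ = _ := by
      rw [hP, lintegral_withDensity_eq_lintegral_mul _ (by fun_prop) (by fun_prop)]; rfl

/-- Mollification does not increase the energy, up to an enlargement of the domain. -/
lemma energy_mollify_le (hu : LocallyIntegrable u) (hm : Measurable u) {p : ℝ} (hp : 1 ≤ p)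
    {w : E N → ℝ≥0∞} (hw : Measurable w) (R : ℝ) :
    ∫⁻ x in Metric.ball 0 R, ∫⁻ h in Metric.ball 0 1,
        ‖mollify n u (x + h) - mollify n u x‖ₑ ^ p * w h
      ≤ ∫⁻ x in Metric.ball 0 (R + 1), ∫⁻ h in Metric.ball 0 1, ‖u (x + h) - u x‖ₑ ^ p * w h := by
  set F : E N → ℝ≥0∞ := fun x => ∫⁻ h in Metric.ball 0 1, ‖u (x + h) - u x‖ₑ ^ p * w h with hF
  have hFm : Measurable F := Measurable.lintegral_prod_right' (ν := volume.restrict _)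
    (f := fun z : E N × E N => ‖u (z.1 + z.2) - u z.1‖ₑ ^ p * w z.2) (by fun_prop)
  have h1 : ∀ x, ∫⁻ h in Metric.ball 0 1, ‖mollify n u (x + h) - mollify n u x‖ₑ ^ p * w h
      ≤ ∫⁻ t, ENNReal.ofReal (mollifier N n t) * F (x - t) := by
    intro x
    calc _ ≤ ∫⁻ h in Metric.ball 0 1, ∫⁻ t, ENNReal.ofReal (mollifier N n t) *
            (‖u (x - t + h) - u (x - t)‖ₑ ^ p * w h) := by
          refine lintegral_mono fun h => ?_
          simp only [← mul_assoc]
          rw [lintegral_mul_const _ (by fun_prop)]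
          gcongr
          exact enorm_mollify_sub_rpow_le n hu hm hp x h
      _ = ∫⁻ t, ∫⁻ h in Metric.ball 0 1, ENNReal.ofReal (mollifier N n t) *
            (‖u (x - t + h) - u (x - t)‖ₑ ^ p * w h) :=
          lintegral_lintegral_swap (by fun_prop)
      _ = _ := by
          refine lintegral_congr fun t => ?_
          rw [lintegral_const_mul _ (by fun_prop)]
  calc _ ≤ ∫⁻ x in Metric.ball 0 R, ∫⁻ t, ENNReal.ofReal (mollifier N n t) * F (x - t) :=
        lintegral_mono fun x => h1 x
    _ = ∫⁻ t, ∫⁻ x in Metric.ball 0 R, ENNReal.ofReal (mollifier N n t) * F (x - t) :=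
        lintegral_lintegral_swap (by fun_prop)
    _ ≤ ∫⁻ t, ENNReal.ofReal (mollifier N n t) * ∫⁻ x in Metric.ball 0 (R + 1), F x := by
        refine lintegral_mono fun t => ?_
        rw [lintegral_const_mul _ (by fun_prop)]
        by_cases ht : mollifier N n t = 0
        · simp [ht]
        gcongr _ * ?_
        have ht1 := norm_lt_of_mollifier_ne_zero n ht
        rw [← lintegral_indicator Metric.isOpen_ball.measurableSet,
          ← lintegral_indicator Metric.isOpen_ball.measurableSet,
          ← lintegral_sub_right_eq_self ((Metric.ball 0 (R + 1)).indicator F) t]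
        refine lintegral_mono fun x => ?_
        by_cases hx : x ∈ Metric.ball 0 R
        · have : x - t ∈ Metric.ball 0 (R + 1) := by
            rw [mem_ball_zero_iff] at hx ⊢
            exact (norm_sub_le _ _).trans_lt (by linarith)
          rw [Set.indicator_of_mem hx, Set.indicator_of_mem this]
        · rw [Set.indicator_of_notMem hx]; exact zero_le
    _ = _ := by rw [lintegral_mul_const _ (by fun_prop), lintegral_mollifier, one_mul]

end mollifier

/-! ### The energy of a differentiable function as the kernel concentrates -/

/-- Differentiability at `x` compares `p`-th powers of the linearised and the true difference, with
an error of small order `|h|^p`. -/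
lemma exists_abs_inner_gradient_rpow_le {N : ℕ} {v : E N → ℝ} {x : E N}
    (hv : DifferentiableAt ℝ v x) {p : ℝ} (hp : 0 < p) {ε : ℝ} (hε : 0 < ε) :
    ∃ r, 0 < r ∧ r ≤ 1 ∧ ∀ h : E N, ‖h‖ < r →
      |inner ℝ (gradient v x) h| ^ p ≤ |v (x + h) - v x| ^ p + ε * ‖h‖ ^ p := by
  -- After division by `‖h‖` both differences lie in `[0, G + 1]`, where `t ↦ t ^ p` is uniformly
  -- continuous.
  set G := ‖gradient v x‖ with hG
  have hcont : ContinuousOn (fun t : ℝ => t ^ p) (Set.Icc 0 (G + 1)) :=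
    (Real.continuous_rpow_const hp.le).continuousOn
  have hUC := isCompact_Icc.uniformContinuousOn_of_continuous hcont
  obtain ⟨η, hη, hUC⟩ := Metric.uniformContinuousOn_iff.1 hUC ε hε
  set η' := min (η / 2) 1 with hη'
  have hη'0 : 0 < η' := by positivity
  have hlin := hv.hasGradientAt.hasFDerivAt
  rw [hasFDerivAt_iff_isLittleO_nhds_zero] at hlin
  obtain ⟨r, hr, hball⟩ := Metric.eventually_nhds_iff.1 (hlin.bound hη'0)
  refine ⟨min r 1, by positivity, min_le_right _ _, fun h hh => ?_⟩
  by_cases h0 : h = 0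
  · simp [h0, Real.zero_rpow hp.ne']
  have hn : 0 < ‖h‖ := norm_pos_iff.2 h0
  have h1 := hball (show dist h 0 < r by simpa using hh.trans_le (min_le_left _ _))
  have h2 : |v (x + h) - v x - inner ℝ (gradient v x) h| ≤ η' * ‖h‖ := by simpa using h1
  set a := |inner ℝ (gradient v x) h| / ‖h‖ with ha
  set b := |v (x + h) - v x| / ‖h‖ with hb
  have haG : a ≤ G := by
    rw [ha, div_le_iff₀ hn]; exact abs_real_inner_le_norm _ _
  have hab : |a - b| ≤ η' := by
    rw [ha, hb, ← sub_div, abs_div, abs_of_pos hn, div_le_iff₀ hn]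
    refine le_trans (abs_abs_sub_abs_le_abs_sub _ _) ?_
    rwa [abs_sub_comm]
  have ha0 : 0 ≤ a := by positivity
  have hb0 : 0 ≤ b := by positivity
  have hbG : b ≤ G + 1 := by
    have := (abs_le.1 hab).1
    have h3 : η' ≤ 1 := min_le_right _ _
    linarith
  have hd : dist a b < η := by
    rw [Real.dist_eq]
    refine hab.trans_lt ((min_le_left _ _).trans_lt (by linarith))
  have h4 := hUC a ⟨ha0, by linarith⟩ b ⟨hb0, hbG⟩ hd
  rw [Real.dist_eq] at h4
  have h5 : a ^ p ≤ b ^ p + ε := by linarith [le_abs_self (a ^ p - b ^ p)]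
  have e1 : |inner ℝ (gradient v x) h| = a * ‖h‖ := by rw [ha]; field_simp
  have e2 : |v (x + h) - v x| = b * ‖h‖ := by rw [hb]; field_simp
  rw [e1, e2, Real.mul_rpow ha0 hn.le, Real.mul_rpow hb0 hn.le, ← add_mul]
  gcongr

/-- At a point of differentiability, the normalised energy density is asymptotically at least
`K |∇v|^p`: near the point the differences are those of the linearisation, and only small `h`
matter as `δ → 0`. -/
lemma le_liminf_energy_density {N : ℕ} (hN : 1 ≤ N) {e : E N} (he : ‖e‖ = 1) {v : E N → ℝ}
    (hm : Measurable v) {x : E N} (hv : DifferentiableAt ℝ v x) {p : ℝ} (hp : 0 < p) {δ : ℕ → ℝ}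
    (hδ : ∀ n, 0 < δ n) (hδ0 : Tendsto δ atTop (𝓝 0)) :
    ENNReal.ofReal (sphereConst N p e) * ‖gradient v x‖ₑ ^ p
      ≤ liminf (fun n => ENNReal.ofReal (δ n) * ∫⁻ h in Metric.ball 0 1,
          ‖v (x + h) - v x‖ₑ ^ p * radialWeight N (δ n - p) h) atTop := by
  set K := ENNReal.ofReal (sphereConst N p e) with hK
  -- The error `ε |h|^p` costs at most `ε` times the total mass of the sphere in the limit.
  have hsub : ∀ ε : ℝ, 0 < ε → K * ‖gradient v x‖ₑ ^ p ≤
      liminf (fun n => ENNReal.ofReal (δ n) * ∫⁻ h in Metric.ball 0 1,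
          ‖v (x + h) - v x‖ₑ ^ p * radialWeight N (δ n - p) h) atTop
        + ENNReal.ofReal (ε * sphereConst N 0 e) := by
    intro ε hε
    obtain ⟨r, hr, hr1, hle⟩ := exists_abs_inner_gradient_rpow_le hv hp hε
    have hpt : ∀ n, ∀ h ∈ Metric.ball (0 : E N) r,
        ‖inner ℝ (gradient v x) h‖ₑ ^ p * radialWeight N (δ n - p) h
          ≤ ‖v (x + h) - v x‖ₑ ^ p * radialWeight N (δ n - p) h
            + ENNReal.ofReal ε * radialWeight N (δ n) h := by
      intro n h hh
      by_cases h0 : h = 0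
      · simp [h0, hp]
      have hn : 0 < ‖h‖ := norm_pos_iff.2 h0
      have hw : radialWeight N (δ n) h
          = ENNReal.ofReal (‖h‖ ^ p) * radialWeight N (δ n - p) h := by
        rw [radialWeight, radialWeight, ← ENNReal.ofReal_mul (by positivity), ← Real.rpow_add hn]
        congr 2; ring
      rw [hw, ← mul_assoc, ← add_mul]
      gcongr
      rw [Real.enorm_eq_ofReal_abs, Real.enorm_eq_ofReal_abs,
        ENNReal.ofReal_rpow_of_nonneg (abs_nonneg _) hp.le,
        ENNReal.ofReal_rpow_of_nonneg (abs_nonneg _) hp.le, ← ENNReal.ofReal_mul hε.le,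
        ← ENNReal.ofReal_add (by positivity) (by positivity)]
      exact ENNReal.ofReal_le_ofReal (hle h (by simpa using hh))
    have hint : ∀ n, K * ‖gradient v x‖ₑ ^ p * ENNReal.ofReal (r ^ δ n)
        ≤ ENNReal.ofReal (δ n) * (∫⁻ h in Metric.ball 0 1,
          ‖v (x + h) - v x‖ₑ ^ p * radialWeight N (δ n - p) h)
          + ENNReal.ofReal (ε * sphereConst N 0 e) := by
      intro n
      have h1 := setLIntegral_mono' (μ := volume) Metric.isOpen_ball.measurableSet (hpt n)
      rw [lintegral_inner_rpow_ball_eq hN hp (hδ n) hr he, lintegral_add_left (by fun_prop),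
        lintegral_const_mul _ (by fun_prop), lintegral_radialWeight_ball hN (hδ n) hr e,
        ← ENNReal.ofReal_mul hε.le] at h1
      have h2 : ENNReal.ofReal (δ n) * ENNReal.ofReal (r ^ δ n / δ n)
          = ENNReal.ofReal (r ^ δ n) := by
        rw [← ENNReal.ofReal_mul (hδ n).le, mul_div_cancel₀ _ (hδ n).ne']
      calc _ = ENNReal.ofReal (δ n) * (K * ENNReal.ofReal (r ^ δ n / δ n)
              * ‖gradient v x‖ₑ ^ p) := by rw [← h2]; ring
        _ ≤ ENNReal.ofReal (δ n) * _ := mul_le_mul' le_rfl h1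
        _ ≤ _ := by
          rw [mul_add]
          refine add_le_add
            (mul_le_mul' le_rfl (lintegral_mono_set (Metric.ball_subset_ball hr1))) ?_
          rw [← ENNReal.ofReal_mul (hδ n).le]
          apply ENNReal.ofReal_le_ofReal
          have h3 : r ^ δ n ≤ 1 := Real.rpow_le_one hr.le hr1 (hδ n).le
          have h4 := (hδ n).ne'
          calc δ n * (ε * (sphereConst N 0 e * (r ^ δ n / δ n)))
              = ε * sphereConst N 0 e * r ^ δ n := by field_simp
            _ ≤ _ := mul_le_of_le_one_right (mul_nonneg hε.le (sphereConst_nonneg _ _ _)) h3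
    have hlim : Tendsto (fun n => K * ‖gradient v x‖ₑ ^ p * ENNReal.ofReal (r ^ δ n)
        - ENNReal.ofReal (ε * sphereConst N 0 e)) atTop
        (𝓝 (K * ‖gradient v x‖ₑ ^ p - ENNReal.ofReal (ε * sphereConst N 0 e))) := by
      have h1 : Tendsto (fun n => ENNReal.ofReal (r ^ δ n)) atTop (𝓝 1) := by
        rw [← ENNReal.ofReal_one, ← Real.rpow_zero r]
        exact ENNReal.tendsto_ofReal (((Real.continuous_const_rpow hr.ne').tendsto 0).comp hδ0)
      have h2 := ENNReal.Tendsto.const_mul (a := K * ‖gradient v x‖ₑ ^ p) h1 (Or.inl one_ne_zero)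
      rw [mul_one] at h2
      exact ENNReal.Tendsto.sub h2 tendsto_const_nhds (Or.inr ENNReal.ofReal_ne_top)
    rw [← tsub_le_iff_right, ← hlim.liminf_eq]
    exact liminf_le_liminf (Eventually.of_forall fun n => tsub_le_iff_right.2 (hint n))
  refine ENNReal.le_of_forall_pos_le_add fun ε hε _ => ?_
  set S := sphereConst N 0 e with hS
  have hS0 : 0 ≤ S := sphereConst_nonneg _ _ _
  refine (hsub (ε / (S + 1)) (by positivity)).trans ?_
  gcongr
  rw [← ENNReal.ofReal_coe_nnreal]
  apply ENNReal.ofReal_le_ofReal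
  rw [div_mul_eq_mul_div, div_le_iff₀ (by positivity)]
  have : (0 : ℝ) ≤ ε := ε.2
  nlinarith

lemma le_liminf_energy {N : ℕ} (hN : 1 ≤ N) {e : E N} (he : ‖e‖ = 1) {v : E N → ℝ}
    (hv : Differentiable ℝ v) {p : ℝ} (hp : 0 < p) {δ : ℕ → ℝ}
    (hδ : ∀ n, 0 < δ n) (hδ0 : Tendsto δ atTop (𝓝 0)) (B : Set (E N)) :
    ENNReal.ofReal (sphereConst N p e) * ∫⁻ x in B, ‖gradient v x‖ₑ ^ p
      ≤ liminf (fun n => ENNReal.ofReal (δ n) * ∫⁻ x in B, ∫⁻ h in Metric.ball 0 1,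
          ‖v (x + h) - v x‖ₑ ^ p * radialWeight N (δ n - p) h) atTop := by
  have hm : Measurable v := hv.continuous.measurable
  have hF : ∀ n, Measurable fun x => ∫⁻ h in Metric.ball 0 1,
          ‖v (x + h) - v x‖ₑ ^ p * radialWeight N (δ n - p) h := fun n =>
    Measurable.lintegral_prod_right' (ν := volume.restrict _)
      (f := fun z : E N × E N => ‖v (z.1 + z.2) - v z.1‖ₑ ^ p * radialWeight N (δ n - p) z.2)
      (by fun_prop)
  rw [← lintegral_const_mul' _ _ ENNReal.ofReal_ne_top]
  refine (lintegral_mono fun x => le_liminf_energy_density hN he hm (hv x) hp hδ hδ0).trans ?_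
  refine (lintegral_liminf_le fun n => (hF n).const_mul _).trans (le_of_eq ?_)
  congr 1; ext n
  exact lintegral_const_mul' _ _ ENNReal.ofReal_ne_top

/-! ### Gradient bound for mollifications -/

/-- The pairs `(y + h, y)` with `y` in the ball of radius `R` and `|h| < 1`. -/
def nearDiagonal (N : ℕ) (R : ℝ) : Set (E N × E N) :=
  {z | z.2 ∈ Metric.ball 0 R ∧ z.1 - z.2 ∈ Metric.ball 0 1}

lemma measurableSet_nearDiagonal (N : ℕ) (R : ℝ) : MeasurableSet (nearDiagonal N R) := by
  have h1 : MeasurableSet {z : E N × E N | z.2 ∈ Metric.ball (0 : E N) R} :=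
    measurable_snd Metric.isOpen_ball.measurableSet
  have h2 : MeasurableSet {z : E N × E N | z.1 - z.2 ∈ Metric.ball (0 : E N) 1} :=
    (measurable_fst.sub measurable_snd) Metric.isOpen_ball.measurableSet
  exact h1.inter h2

/-- Tonelli's theorem in the coordinates `(y, h)` with `x = y + h`. -/
lemma lintegral_nearDiagonal {N : ℕ} (R : ℝ) {F : E N × E N → ℝ≥0∞} (hF : Measurable F) :
    ∫⁻ z in nearDiagonal N R, F z
      = ∫⁻ y in Metric.ball 0 R, ∫⁻ h in Metric.ball 0 1, F (y + h, y) := by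
  have hS := measurableSet_nearDiagonal N R
  rw [← lintegral_indicator hS, Measure.volume_eq_prod,
    lintegral_prod_symm _ (hF.indicator hS).aemeasurable,
    ← lintegral_indicator Metric.isOpen_ball.measurableSet]
  refine lintegral_congr fun y => ?_
  by_cases hy : y ∈ Metric.ball 0 R
  · rw [Set.indicator_of_mem hy, ← lintegral_indicator Metric.isOpen_ball.measurableSet,
      ← lintegral_add_left_eq_self _ y]
    refine lintegral_congr fun h => ?_
    by_cases hh : h ∈ Metric.ball 0 1
    · rw [Set.indicator_of_mem hh, Set.indicator_of_mem]
      exact ⟨hy, by simpa using hh⟩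
    · rw [Set.indicator_of_notMem hh, Set.indicator_of_notMem]
      exact fun h' => hh (by simpa using h'.2)
  · rw [Set.indicator_of_notMem hy, ← lintegral_zero]
    refine lintegral_congr fun x => ?_
    rw [Set.indicator_of_notMem]
    exact fun h' => hy h'.1

lemma nu_nearDiagonal_lt_top {N : ℕ} (hN : 1 ≤ N) {γ : ℝ} (hγ : 0 < γ) (R : ℝ) :
    nu N γ (nearDiagonal N R) < ⊤ := by
  have h1 : nu N γ (nearDiagonal N R)
      = ∫⁻ z in nearDiagonal N R, radialWeight N γ (z.1 - z.2) :=
    withDensity_apply _ (measurableSet_nearDiagonal N R)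
  rw [h1, lintegral_nearDiagonal R (by fun_prop)]
  simp only [add_sub_cancel_left]
  rw [lintegral_radialWeight_ball hN hγ one_pos 0, lintegral_const, Measure.restrict_apply_univ]
  exact ENNReal.mul_lt_top ENNReal.ofReal_lt_top measure_ball_lt_top

/-- The bound of the superlevel sets, passed to the limit `δ → 0`. -/
lemma limsup_energy_le {N : ℕ} (hN : 1 ≤ N) {u : E N → ℝ} (hu : Measurable u) {M p γ : ℝ}
    (hM : 0 < M) (hb : ∀ x, |u x| ≤ M) (hp : 1 ≤ p) (hγ : 0 < γ) {A : ℝ≥0∞}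
    (hA : ∀ᶠ l in atTop, PhiL p γ u l ≤ A) {δ : ℕ → ℝ} (hδ : ∀ n, 0 < δ n)
    (hδ0 : Tendsto δ atTop (𝓝 0)) (R : ℝ) :
    limsup (fun n => ENNReal.ofReal (δ n) * ∫⁻ x in Metric.ball 0 R, ∫⁻ h in Metric.ball 0 1,
          ‖u (x + h) - u x‖ₑ ^ p * radialWeight N (δ n - p) h) atTop
      ≤ ENNReal.ofReal (p + γ) * A := by
  by_cases hAtop : A = ⊤
  · rw [hAtop, ENNReal.mul_top (by simp; linarith)]; exact le_top
  obtain ⟨Λ₀, hΛ₀⟩ := eventually_atTop.1 hA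
  set Λ := max Λ₀ 1 with hΛdef
  have hΛ : 0 < Λ := by positivity
  have hA' : ∀ l, Λ ≤ l → PhiL p γ u l ≤ A := fun l hl => hΛ₀ l ((le_max_left _ _).trans hl)
  have hp0 : 0 < p := by linarith
  have hpg : 0 < p + γ := by linarith
  set V := nu N γ (nearDiagonal N R) with hV
  have hVtop : V ≠ ⊤ := (nu_nearDiagonal_lt_top hN hγ R).ne
  set s : ℝ → ℝ := fun d => d * p / (p + γ) with hs
  have hsc : Continuous s := by fun_prop
  -- The bound of `energy_le_of_PhiL_le`, multiplied by `δ`, as a continuous function of `δ`.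
  set Bd : ℝ → ℝ≥0∞ := fun d => ENNReal.ofReal ((2 * M) ^ s d) *
    (ENNReal.ofReal (d * Λ ^ (p - s d)) * V
      + ENNReal.ofReal ((p - s d) * (p + γ) / p * Λ ^ (-s d)) * A) with hBd
  have hle : ∀ᶠ n in atTop, ENNReal.ofReal (δ n) * (∫⁻ x in Metric.ball 0 R,
      ∫⁻ h in Metric.ball 0 1, ‖u (x + h) - u x‖ₑ ^ p * radialWeight N (δ n - p) h)
        ≤ Bd (δ n) := by
    filter_upwards [hδ0.eventually (gt_mem_nhds hpg)] with n hn
    have h1 := energy_le_of_PhiL_le hu hM hb hp hγ (hδ n) hn hΛ hA' (measurableSet_nearDiagonal N R)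
    rw [lintegral_nearDiagonal R (by fun_prop)] at h1
    simp only [add_sub_cancel_left] at h1
    refine (mul_le_mul' le_rfl h1).trans (le_of_eq ?_)
    have hsd : δ n * p / (p + γ) = s (δ n) := rfl
    rw [hsd, hBd]
    simp only
    have hs0 : 0 < s (δ n) := by have := hδ n; simp only [hs]; positivity
    rw [mul_left_comm, mul_add, ← mul_assoc, ← mul_assoc, ← ENNReal.ofReal_mul (hδ n).le,
      ← ENNReal.ofReal_mul (hδ n).le]
    congr 4
    have h2 : s (δ n) * (p + γ) = δ n * p := by simp only [hs]; field_simp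
    rw [← mul_assoc]
    congr 1
    rw [← mul_div_assoc, div_eq_div_iff hs0.ne' hp0.ne']
    linear_combination -(p - s (δ n)) * h2
  have hlim : Tendsto (fun n => Bd (δ n)) atTop (𝓝 (ENNReal.ofReal (p + γ) * A)) := by
    have hs0 : s 0 = 0 := by simp [hs]
    have c1 : Continuous fun d => (2 * M) ^ s d :=
      (Real.continuous_const_rpow (by positivity)).comp hsc
    have c2 : Continuous fun d => d * Λ ^ (p - s d) :=
      continuous_id.mul ((Real.continuous_const_rpow hΛ.ne').comp (by fun_prop))
    have c3 : Continuous fun d => (p - s d) * (p + γ) / p * Λ ^ (-s d) :=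
      Continuous.mul (by fun_prop) ((Real.continuous_const_rpow hΛ.ne').comp (by fun_prop))
    have t1 := ENNReal.tendsto_ofReal ((c1.tendsto 0).comp hδ0)
    have t2 := ENNReal.tendsto_ofReal ((c2.tendsto 0).comp hδ0)
    have t3 := ENNReal.tendsto_ofReal ((c3.tendsto 0).comp hδ0)
    simp only [hs0, Real.rpow_zero, zero_mul, sub_zero, neg_zero, mul_one, ENNReal.ofReal_one,
      ENNReal.ofReal_zero, mul_div_cancel_left₀ _ hp0.ne'] at t1 t2 t3
    have t4 := (ENNReal.Tendsto.mul_const t2 (b := V) (Or.inr hVtop)).add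
      (ENNReal.Tendsto.mul_const t3 (b := A) (Or.inr hAtop))
    have t5 := ENNReal.Tendsto.mul t1 (Or.inl one_ne_zero) t4 (Or.inr ENNReal.one_ne_top)
    simpa using t5
  rw [← hlim.limsup_eq]
  exact limsup_le_limsup hle

lemma locallyIntegrable_of_bounded {N : ℕ} {u : E N → ℝ} (hu : Measurable u) {M : ℝ}
    (hb : ∀ x, |u x| ≤ M) : LocallyIntegrable u :=
  (locallyIntegrable_const M).mono hu.aestronglyMeasurable
    (Eventually.of_forall fun x => by
      rw [Real.norm_eq_abs, Real.norm_eq_abs]; exact (hb x).trans (le_abs_self _))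

lemma gradient_mollify_bound_of_bounded {N : ℕ} (hN : 1 ≤ N) {e : E N} (he : ‖e‖ = 1)
    {u : E N → ℝ} (hu : Measurable u) {M p γ : ℝ} (hM : 0 < M) (hb : ∀ x, |u x| ≤ M) (hp : 1 ≤ p)
    (hγ : 0 < γ) {A : ℝ≥0∞} (hA : ∀ᶠ l in atTop, PhiL p γ u l ≤ A) (n : ℕ) :
    ENNReal.ofReal (sphereConst N p e) * ∫⁻ x, ‖gradient (mollify n u) x‖ₑ ^ p
      ≤ ENNReal.ofReal (p + γ) * A := by
  have hloc := locallyIntegrable_of_bounded hu hb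
  set δ : ℕ → ℝ := fun k => 1 / ((k : ℝ) + 1) with hδdef
  have hδ : ∀ k, 0 < δ k := fun k => by positivity
  have hδ0 : Tendsto δ atTop (𝓝 0) := tendsto_one_div_add_atTop_nhds_zero_nat
  have hball : ∀ R : ℝ, ENNReal.ofReal (sphereConst N p e) *
      ∫⁻ x in Metric.ball 0 R, ‖gradient (mollify n u) x‖ₑ ^ p ≤ ENNReal.ofReal (p + γ) * A := by
    intro R
    refine (le_liminf_energy hN he (mollify_differentiable n hloc) (by linarith) hδ hδ0 _).trans ?_
    refine le_trans ?_ (limsup_energy_le hN hu hM hb hp hγ hA hδ hδ0 (R + 1))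
    refine le_trans liminf_le_limsup (limsup_le_limsup (Eventually.of_forall fun k => ?_))
    exact mul_le_mul' le_rfl (energy_mollify_le n hloc hu hp (by fun_prop) R)
  have hmono : Monotone fun k : ℕ => Metric.ball (0 : E N) k := fun a b hab =>
    Metric.ball_subset_ball (by exact_mod_cast hab)
  have hU : ⋃ k : ℕ, Metric.ball (0 : E N) k = Set.univ := Metric.iUnion_ball_nat 0
  have h1 := setLIntegral_iUnion_of_directed (μ := volume)
    (fun x => ‖gradient (mollify n u) x‖ₑ ^ p) hmono.directed_le
  rw [hU, setLIntegral_univ] at h1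
  rw [h1, ENNReal.mul_iSup]
  exact iSup_le fun k => hball k

/-! ### Removal of the bound on the function -/

lemma norm_gradient {N : ℕ} (v : E N → ℝ) (x : E N) : ‖gradient v x‖ = ‖fderiv ℝ v x‖ := by
  rw [gradient, LinearIsometryEquiv.norm_map]

lemma enorm_gradient {N : ℕ} (v : E N → ℝ) (x : E N) : ‖gradient v x‖ₑ = ‖fderiv ℝ v x‖ₑ := by
  rw [← ofReal_norm, ← ofReal_norm, norm_gradient]

lemma fderiv_mollify_eq_convolution {N : ℕ} (n : ℕ) {u : E N → ℝ} (hu : LocallyIntegrable u)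
    (x : E N) : fderiv ℝ (mollify n u) x = ∫ t, (ContinuousLinearMap.precompL (E N)
      (ContinuousLinearMap.lsmul ℝ ℝ)) (fderiv ℝ (mollifier N n) t) (u (x - t)) :=
  ((mollifier_hasCompactSupport n).hasFDerivAt_convolution_left (ContinuousLinearMap.lsmul ℝ ℝ)
    ((mollifier_contDiff n).of_le (by simp)) hu x).fderiv

lemma integrable_fderiv_mollifier_precompL {N : ℕ} (n : ℕ) {u : E N → ℝ} (hu : LocallyIntegrable u)
    (x : E N) : Integrable fun t => (ContinuousLinearMap.precompL (E N)
      (ContinuousLinearMap.lsmul ℝ ℝ)) (fderiv ℝ (mollifier N n) t) (u (x - t)) :=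
  ((mollifier_hasCompactSupport n).fderiv ℝ).convolutionExists_left _
    ((mollifier_contDiff n).continuous_fderiv (by simp)) hu x

lemma precompL_apply_norm_le {N : ℕ} (L : E N →L[ℝ] ℝ) (a b : ℝ) (h : |a| ≤ |b|) :
    ‖(ContinuousLinearMap.precompL (E N) (ContinuousLinearMap.lsmul ℝ ℝ)) L a‖
      ≤ ‖(ContinuousLinearMap.precompL (E N) (ContinuousLinearMap.lsmul ℝ ℝ)) L b‖ := by
  have key : ∀ c : ℝ, (ContinuousLinearMap.precompL (E N) (ContinuousLinearMap.lsmul ℝ ℝ)) L c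
      = c • L := by
    intro c; ext y; simp [mul_comm]
  rw [key, key, norm_smul, norm_smul]
  exact mul_le_mul_of_nonneg_right h (norm_nonneg _)

/-- The truncation of a function at heights `±M`. -/
def truncate {N : ℕ} (M : ℝ) (u : E N → ℝ) (x : E N) : ℝ := max (-M) (min (u x) M)

lemma abs_truncate_le {N : ℕ} {M : ℝ} (hM : 0 ≤ M) (u : E N → ℝ) (x : E N) :
    |truncate M u x| ≤ M := by
  rw [abs_le]
  exact ⟨le_max_left _ _, max_le (by linarith) (min_le_right _ _)⟩

lemma abs_truncate_le_abs {N : ℕ} {M : ℝ} (hM : 0 ≤ M) (u : E N → ℝ) (x : E N) :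
    |truncate M u x| ≤ |u x| := by
  unfold truncate
  rcases le_total (u x) M with h | h
  · rw [min_eq_left h]
    rcases le_total (-M) (u x) with h' | h'
    · rw [max_eq_right h']
    · rw [max_eq_left h', abs_neg, abs_of_nonneg hM, abs_of_nonpos (by linarith)]; linarith
  · rw [min_eq_right h, max_eq_right (by linarith), abs_of_nonneg hM,
      abs_of_nonneg (by linarith)]; exact h

lemma abs_truncate_sub_le {N : ℕ} (M : ℝ) (u : E N → ℝ) (x y : E N) :
    |truncate M u x - truncate M u y| ≤ |u x - u y| := by
  unfold truncate
  refine (abs_max_sub_max_le_max _ _ _ _).trans ?_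
  rw [sub_self, abs_zero, max_eq_right (abs_nonneg _)]
  refine (abs_min_sub_min_le_max _ _ _ _).trans ?_
  rw [sub_self, abs_zero, max_eq_left (abs_nonneg _)]

lemma truncate_eq_self {N : ℕ} {M : ℝ} {u : E N → ℝ} {x : E N} (h : |u x| ≤ M) :
    truncate M u x = u x := by
  have := abs_le.1 h
  rw [truncate, min_eq_left this.2, max_eq_right this.1]

lemma PhiL_truncate_le {N : ℕ} (p γ M : ℝ) (u : E N → ℝ) (l : ℝ) :
    PhiL p γ (truncate M u) l ≤ PhiL p γ u l := by
  unfold PhiL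
  gcongr
  intro z hz
  have hz' : l < |diffQuot (γ / p) (truncate M u) z| := hz
  refine lt_of_lt_of_le hz' ?_
  unfold diffQuot
  rw [abs_div, abs_div]
  exact div_le_div_of_nonneg_right (abs_truncate_sub_le _ _ _ _) (abs_nonneg _)

lemma gradient_mollify_bound_of_measurable {N : ℕ} (hN : 1 ≤ N) {e : E N} (he : ‖e‖ = 1)
    {u : E N → ℝ} (hu : Measurable u) (hloc : LocallyIntegrable u) {p γ : ℝ} (hp : 1 ≤ p)
    (hγ : 0 < γ) {A : ℝ≥0∞} (hA : ∀ᶠ l in atTop, PhiL p γ u l ≤ A) (n : ℕ) :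
    ENNReal.ofReal (sphereConst N p e) * ∫⁻ x, ‖gradient (mollify n u) x‖ₑ ^ p
      ≤ ENNReal.ofReal (p + γ) * A := by
  set T : ℕ → E N → ℝ := fun k => truncate ((k : ℝ) + 1) u with hT
  have hTm : ∀ k, Measurable (T k) := fun k => by
    simp only [hT]; unfold truncate; fun_prop
  have hTb : ∀ k x, |T k x| ≤ (k : ℝ) + 1 := fun k x => abs_truncate_le (by positivity) u x
  have hTl : ∀ k, LocallyIntegrable (T k) := fun k => locallyIntegrable_of_bounded (hTm k) (hTb k)
  have hbd : ∀ k, ENNReal.ofReal (sphereConst N p e) *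
      ∫⁻ x, ‖gradient (mollify n (T k)) x‖ₑ ^ p ≤ ENNReal.ofReal (p + γ) * A := fun k =>
    gradient_mollify_bound_of_bounded hN he (hTm k) (by positivity) (hTb k) hp hγ
      (hA.mono fun l hl => (PhiL_truncate_le p γ _ u l).trans hl) n
  -- The derivative falls on the mollifier, so dominated convergence gives pointwise convergence.
  have hlim : ∀ x, Tendsto (fun k => fderiv ℝ (mollify n (T k)) x) atTop
      (𝓝 (fderiv ℝ (mollify n u) x)) := by
    intro x
    rw [fderiv_mollify_eq_convolution n hloc]
    simp only [fun k => fderiv_mollify_eq_convolution n (hTl k) x]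
    refine tendsto_integral_of_dominated_convergence
      (fun t => ‖(ContinuousLinearMap.precompL (E N) (ContinuousLinearMap.lsmul ℝ ℝ))
        (fderiv ℝ (mollifier N n) t) (u (x - t))‖)
      (fun k => (integrable_fderiv_mollifier_precompL n (hTl k) x).aestronglyMeasurable)
      (integrable_fderiv_mollifier_precompL n hloc x).norm ?_ ?_
    · exact fun k => Eventually.of_forall fun t =>
        precompL_apply_norm_le _ _ _ (abs_truncate_le_abs (by positivity) u _)
    · refine Eventually.of_forall fun t => tendsto_const_nhds.congr' ?_
      filter_upwards [eventually_ge_atTop ⌈|u (x - t)|⌉₊] with k hk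
      have : |u (x - t)| ≤ (k : ℝ) + 1 := by
        have := Nat.ceil_le.1 hk; linarith
      simp only [hT]
      rw [truncate_eq_self this]
  have hm : ∀ v : E N → ℝ, Measurable fun x => ‖gradient v x‖ₑ ^ p := fun v => by
    simp only [enorm_gradient]
    exact ((measurable_fderiv ℝ v).enorm).pow_const _
  rw [← lintegral_const_mul _ (hm _)]
  calc _ = ∫⁻ x, liminf (fun k => ENNReal.ofReal (sphereConst N p e) *
          ‖gradient (mollify n (T k)) x‖ₑ ^ p) atTop := by
        refine lintegral_congr fun x => (Tendsto.liminf_eq ?_).symm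
        simp only [enorm_gradient]
        refine ENNReal.Tendsto.const_mul ?_ (Or.inr ENNReal.ofReal_ne_top)
        exact ((ENNReal.continuous_rpow_const.tendsto _).comp
          ((continuous_enorm.tendsto _).comp (hlim x)))
    _ ≤ liminf (fun k => ∫⁻ x, ENNReal.ofReal (sphereConst N p e) *
          ‖gradient (mollify n (T k)) x‖ₑ ^ p) atTop :=
        lintegral_liminf_le fun k => (hm _).const_mul _
    _ ≤ ENNReal.ofReal (p + γ) * A := by
        refine liminf_le_of_le (by isBoundedDefault) fun b hb => ?_
        obtain ⟨k, hk⟩ := hb.exists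
        refine hk.trans ?_
        rw [lintegral_const_mul _ (hm _)]
        exact hbd k

lemma mollify_congr_ae {N : ℕ} (n : ℕ) {u v : E N → ℝ} (h : u =ᵐ[volume] v) :
    mollify n u = mollify n v := by
  ext x
  rw [mollify_apply_swap, mollify_apply_swap]
  refine integral_congr_ae ?_
  filter_upwards [h] with t ht
  rw [ht]

lemma PhiL_congr_ae {N : ℕ} (p γ : ℝ) {u v : E N → ℝ} (h : u =ᵐ[volume] v) (l : ℝ) :
    PhiL p γ u l = PhiL p γ v l := by
  unfold PhiL
  congr 1
  refine measure_congr ?_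
  have h1 : ∀ᵐ z : E N × E N, u z.1 = v z.1 := Measure.quasiMeasurePreserving_fst.ae h
  have h2 : ∀ᵐ z : E N × E N, u z.2 = v z.2 := Measure.quasiMeasurePreserving_snd.ae h
  have h3 : nu N γ ≪ volume := withDensity_absolutelyContinuous _ _
  filter_upwards [h3.ae_le h1, h3.ae_le h2] with z hz1 hz2
  have : diffQuot (γ / p) u z = diffQuot (γ / p) v z := by rw [diffQuot, diffQuot, hz1, hz2]
  exact congrArg (fun a => l < |a|) this

/-- The gradients of the mollifications are bounded in `L^p` by the upper limit of `Φ_λ`, with the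
constant `K / (γ + p)`. -/
theorem gradient_mollify_bound {N : ℕ} (hN : 1 ≤ N) {e : E N} (he : ‖e‖ = 1)
    {u : E N → ℝ} (hloc : LocallyIntegrable u) {p γ : ℝ} (hp : 1 ≤ p) (hγ : 0 < γ) (n : ℕ) :
    ENNReal.ofReal (sphereConst N p e / (γ + p)) * ∫⁻ x, ‖gradient (mollify n u) x‖ₑ ^ p
      ≤ limsup (fun l : ℝ => PhiL p γ u l) atTop := by
  have hm := hloc.aestronglyMeasurable
  have hae := hm.ae_eq_mk
  have hloc' : LocallyIntegrable (hm.mk u) := hloc.congr hae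
  rw [mollify_congr_ae n hae]
  simp only [PhiL_congr_ae p γ hae]
  have hpg : 0 < γ + p := by linarith
  refine le_of_forall_gt_imp_ge_of_dense fun A hA => ?_
  have h1 := gradient_mollify_bound_of_measurable hN he hm.stronglyMeasurable_mk.measurable hloc' hp
    hγ ((eventually_lt_of_limsup_lt hA).mono fun l hl => hl.le) n
  rw [ENNReal.ofReal_div_of_pos hpg, ENNReal.mul_div_right_comm.symm]
  refine ENNReal.div_le_of_le_mul ?_
  rw [mul_comm A, add_comm γ p]
  exact h1

/-! ### Mollification and test functions -/

section testFunctions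

variable {N : ℕ} {u : E N → ℝ}

lemma integrable_mul_of_hasCompactSupport (hu : LocallyIntegrable u) {ψ : E N → ℝ}
    (hψ : Continuous ψ) (hc : HasCompactSupport ψ) : Integrable fun x => u x * ψ x := by
  have := hu.integrable_smul_left_of_hasCompactSupport hψ hc
  simpa [mul_comm] using this

lemma integrable_mollifier_mul_mul (n : ℕ) (hu : LocallyIntegrable u) {ψ : E N → ℝ}
    (hψ : Continuous ψ) (hc : HasCompactSupport ψ) :
    Integrable (fun z : E N × E N => mollifier N n z.2 * u (z.1 - z.2) * ψ z.1)
      (volume.prod volume) := by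
  -- Only the values of `u` on a compact neighbourhood of the support of `ψ` matter.
  set K := Metric.cthickening 1 (tsupport ψ) with hK
  have hKc : IsCompact K := hc.isCompact.cthickening
  have h1 : Integrable (K.indicator u) :=
    (integrable_indicator_iff hKc.measurableSet).2 (hu.integrableOn_isCompact hKc)
  have h2 := (integrable_mollifier (N := N) n).convolution_integrand
    (ContinuousLinearMap.lsmul ℝ ℝ) h1
  obtain ⟨C, hC⟩ := hc.exists_bound_of_continuous hψ
  have h3 := h2.mul_bdd (g := fun z : E N × E N => ψ z.1) (c := C)
    (hψ.comp continuous_fst).aestronglyMeasurable (Eventually.of_forall fun z => hC z.1)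
  refine h3.congr (Eventually.of_forall fun z => ?_)
  simp only [ContinuousLinearMap.lsmul_apply, smul_eq_mul]
  by_cases hρ : mollifier N n z.2 = 0
  · simp [hρ]
  by_cases hz : z.1 ∈ tsupport ψ
  · rw [Set.indicator_of_mem]
    refine Metric.mem_cthickening_of_dist_le _ z.1 _ _ hz ?_
    simpa [dist_eq_norm] using (norm_lt_of_mollifier_ne_zero n hρ).le
  · simp [image_eq_zero_of_notMem_tsupport hz]

/-- Testing a mollification amounts to averaging the tests of the translates. -/
lemma integral_mollify_mul (n : ℕ) (hu : LocallyIntegrable u) {ψ : E N → ℝ}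
    (hψ : Continuous ψ) (hc : HasCompactSupport ψ) :
    ∫ x, mollify n u x * ψ x = ∫ t, mollifier N n t * ∫ x, u (x - t) * ψ x := by
  have h1 := integral_integral_swap (f := fun x t => mollifier N n t * u (x - t) * ψ x)
    (integrable_mollifier_mul_mul n hu hψ hc)
  simp only [integral_mul_const] at h1
  simp only [mollify_apply]
  rw [h1]
  refine integral_congr_ae (Eventually.of_forall fun t => ?_)
  simp only [mul_assoc, integral_const_mul]

lemma tendsto_integral_mollify_mul (hu : LocallyIntegrable u) {ψ : E N → ℝ}
    (hψ : Continuous ψ) (hc : HasCompactSupport ψ) :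
    Tendsto (fun n => ∫ x, mollify n u x * ψ x) atTop (𝓝 (∫ x, u x * ψ x)) := by
  -- By Fubini the left side is the mollification of the continuous function `G`, taken at `0`.
  set G : E N → ℝ := fun s => ∫ x, u (x + s) * ψ x with hG
  have hψn : HasCompactSupport fun x => ψ (-x) := hc.comp_homeomorph (Homeomorph.neg _)
  have hGc : Continuous G := by
    have h1 : Continuous (convolution u (fun x => ψ (-x)) (ContinuousLinearMap.lsmul ℝ ℝ) volume) :=
      hψn.continuous_convolution_right _ hu (by fun_prop)
    convert h1 using 1
    ext s
    simp only [hG, convolution_lsmul, smul_eq_mul]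
    rw [← integral_add_right_eq_self (fun t => u t * ψ (-(s - t))) s]
    refine integral_congr_ae (Eventually.of_forall fun t => ?_)
    simp
  have h2 := ContDiffBump.convolution_tendsto_right_of_continuous (μ := volume)
    (bump_rOut_tendsto N) hGc 0
  have h3 : G 0 = ∫ x, u x * ψ x := by simp [hG]
  rw [h3] at h2
  refine h2.congr fun n => ?_
  rw [integral_mollify_mul n hu hψ hc, convolution_lsmul]
  refine integral_congr_ae (Eventually.of_forall fun t => ?_)
  simp only [hG, smul_eq_mul, zero_sub, ← sub_eq_add_neg]
  rfl

lemma continuous_fderiv_apply {v : E N → ℝ} (hv : ContDiff ℝ ∞ v) (y : E N) :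
    Continuous fun x => fderiv ℝ v x y :=
  (hv.continuous_fderiv (by simp)).clm_apply continuous_const

lemma hasCompactSupport_fderiv_apply {v : E N → ℝ} (hv : HasCompactSupport v) (y : E N) :
    HasCompactSupport fun x => fderiv ℝ v x y := hv.fderiv_apply ℝ y

/-- Integration by parts against a test function. -/
lemma integral_mul_fderiv_eq_neg {v φ : E N → ℝ} (hv : ContDiff ℝ ∞ v) (hφ : ContDiff ℝ ∞ φ)
    (hc : HasCompactSupport φ) (y : E N) :
    ∫ x, v x * fderiv ℝ φ x y = -∫ x, fderiv ℝ v x y * φ x := by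
  refine integral_mul_fderiv_eq_neg_fderiv_mul_of_integrable ?_ ?_ ?_ ?_ ?_
  · exact ((continuous_fderiv_apply hv y).mul hφ.continuous).integrable_of_hasCompactSupport
      hc.mul_left
  · exact (hv.continuous.mul (continuous_fderiv_apply hφ y)).integrable_of_hasCompactSupport
      (hasCompactSupport_fderiv_apply hc y).mul_left
  · exact (hv.continuous.mul hφ.continuous).integrable_of_hasCompactSupport hc.mul_left
  · exact fun x _ => hv.differentiable (by simp) x
  · exact fun x _ => hφ.differentiable (by simp) x

lemma divergence_eq {φ : E N → E N} (hφ : ContDiff ℝ ∞ φ) (x : E N) :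
    divergence φ x = ∑ i : Fin N, fderiv ℝ (fun y => φ y i) x (EuclideanSpace.single i 1) := by
  unfold divergence
  refine Finset.sum_congr rfl fun i _ => ?_
  have h1 : HasFDerivAt (fun y => φ y i)
      ((EuclideanSpace.proj (𝕜 := ℝ) i).comp (fderiv ℝ φ x)) x :=
    (EuclideanSpace.proj (𝕜 := ℝ) i).hasFDerivAt.comp x
      ((hφ.differentiable (by simp)) x).hasFDerivAt
  rw [h1.fderiv]; rfl

lemma contDiff_coord {φ : E N → E N} (hφ : ContDiff ℝ ∞ φ) (i : Fin N) :
    ContDiff ℝ ∞ fun y => φ y i := (EuclideanSpace.proj (𝕜 := ℝ) i).contDiff.comp hφ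

lemma hasCompactSupport_coord {φ : E N → E N} (hc : HasCompactSupport φ) (i : Fin N) :
    HasCompactSupport fun y => φ y i := hc.comp_left (g := fun v : E N => v i) rfl

lemma continuous_divergence {φ : E N → E N} (hφ : ContDiff ℝ ∞ φ) :
    Continuous (divergence φ) := by
  rw [funext (divergence_eq hφ)]
  exact continuous_finsetSum _ fun i _ => continuous_fderiv_apply (contDiff_coord hφ i) _

lemma hasCompactSupport_divergence {φ : E N → E N} (hc : HasCompactSupport φ) :
    HasCompactSupport (divergence φ) :=
  (hc.fderiv ℝ).comp_left
    (g := fun L : E N →L[ℝ] E N => ∑ i : Fin N, (L (EuclideanSpace.single i 1)) i) (by simp)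

lemma gradient_coord (v : E N → ℝ) (x : E N) (i : Fin N) :
    gradient v x i = fderiv ℝ v x (EuclideanSpace.single i 1) := by
  rw [← inner_gradient_left, EuclideanSpace.inner_single_right]; simp

lemma integral_mul_divergence_eq_neg {v : E N → ℝ} {φ : E N → E N} (hv : ContDiff ℝ ∞ v)
    (hφ : ContDiff ℝ ∞ φ) (hc : HasCompactSupport φ) :
    ∫ x, v x * divergence φ x = -∫ x, inner ℝ (gradient v x) (φ x) := by
  simp only [divergence_eq hφ, Finset.mul_sum]
  rw [integral_finsetSum]
  swap
  · intro i _
    have h2 := hv.continuous.mul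
      (continuous_fderiv_apply (contDiff_coord hφ i) (EuclideanSpace.single i 1))
    exact h2.integrable_of_hasCompactSupport
      (hasCompactSupport_fderiv_apply (hasCompactSupport_coord hc i) _).mul_left
  have h1 : ∀ x, inner ℝ (gradient v x) (φ x)
      = ∑ i : Fin N, fderiv ℝ v x (EuclideanSpace.single i 1) * φ x i := by
    intro x
    rw [PiLp.inner_apply]
    refine Finset.sum_congr rfl fun i _ => ?_
    rw [gradient_coord]; simp [mul_comm]
  simp only [h1]
  rw [integral_finsetSum]
  swap
  · intro i _
    have h2 := (continuous_fderiv_apply hv (EuclideanSpace.single i 1)).mul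
      (contDiff_coord hφ i).continuous
    exact h2.integrable_of_hasCompactSupport (hasCompactSupport_coord hc i).mul_left
  rw [← Finset.sum_neg_distrib]
  exact Finset.sum_congr rfl fun i _ =>
    integral_mul_fderiv_eq_neg hv (contDiff_coord hφ i) (hasCompactSupport_coord hc i) _

/-- Lower semicontinuity of the total variation along mollifications. -/
lemma totalVariation_le_of_mollify (hu : LocallyIntegrable u) {C : ℝ≥0∞}
    (hC : ∀ n, ∫⁻ x, ‖gradient (mollify n u) x‖ₑ ≤ C) : totalVariation u ≤ C := by
  unfold totalVariation
  refine iSup₂_le fun φ hφ => ?_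
  obtain ⟨hφ, hc, hb⟩ := hφ
  have h1 := tendsto_integral_mollify_mul hu (continuous_divergence hφ)
    (hasCompactSupport_divergence hc)
  have h2 : Tendsto (fun n => ENNReal.ofReal |∫ x, mollify n u x * divergence φ x|) atTop
      (𝓝 (ENNReal.ofReal |∫ x, u x * divergence φ x|)) :=
    ENNReal.tendsto_ofReal h1.abs
  refine le_of_tendsto' h2 fun n => le_trans ?_ (hC n)
  rw [integral_mul_divergence_eq_neg (mollify_contDiff n hu) hφ hc, abs_neg,
    ← Real.enorm_eq_ofReal_abs]
  refine (enorm_integral_le_lintegral_enorm _).trans (lintegral_mono fun x => ?_)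
  rw [← ofReal_norm, ← ofReal_norm]
  refine ENNReal.ofReal_le_ofReal ((norm_inner_le_norm _ _).trans ?_)
  exact mul_le_of_le_one_right (norm_nonneg _) (hb x)

end testFunctions

/-! ### Densities of bounded functionals on `L^q` -/

/-- The functions with finite `L^q` seminorm, as a space of functions rather than of classes. -/
def memLpSubmodule {α : Type*} [MeasurableSpace α] (q : ℝ≥0∞) (m : Measure α) :
    Submodule ℝ (α → ℝ) where
  carrier := {f | MemLp f q m}
  add_mem' hf hg := hf.add hg
  zero_mem' := MemLp.zero
  smul_mem' c _ hf := hf.const_smul c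

lemma integrable_mul_of_bounded {α : Type*} [MeasurableSpace α] {m : Measure α} {f ψ : α → ℝ}
    (hf : Integrable f m) (hψ : Measurable ψ) (hb : ∃ b, ∀ x, |ψ x| ≤ b) :
    Integrable (fun x => f x * ψ x) m := by
  obtain ⟨b, hb⟩ := hb
  exact hf.mul_bdd (c := b) hψ.aestronglyMeasurable (Eventually.of_forall hb)

section density

variable {α : Type*} [MeasurableSpace α] {m : Measure α} [IsFiniteMeasure m] {q : ℝ≥0∞}

lemma indicator_one_mem_memLpSubmodule (s : Set α) (hs : MeasurableSet s) :
    s.indicator (fun _ => (1 : ℝ)) ∈ memLpSubmodule q m :=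
  memLp_indicator_const q hs 1 (Or.inr (measure_ne_top m s))

lemma abs_apply_indicator_le (hq1 : 1 ≤ q) (hq : q ≠ ⊤) {g : memLpSubmodule q m →ₗ[ℝ] ℝ} {C : ℝ}
    (hg : ∀ f, |g f| ≤ C * (eLpNorm (f : α → ℝ) q m).toReal) {s : Set α} (hs : MeasurableSet s) :
    |g ⟨_, indicator_one_mem_memLpSubmodule s hs⟩| ≤ C * (m s ^ (1 / q.toReal)).toReal := by
  refine (hg _).trans (le_of_eq ?_)
  rw [eLpNorm_indicator_const hs (by positivity) hq]
  simp

/-- The signed measure `A ↦ g(1_A)` of a bounded functional `g` on `L^q`. -/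
lemma exists_signedMeasure (hq1 : 1 ≤ q) (hq : q ≠ ⊤) (g : memLpSubmodule q m →ₗ[ℝ] ℝ) {C : ℝ}
    (hg : ∀ f, |g f| ≤ C * (eLpNorm (f : α → ℝ) q m).toReal) :
    ∃ ν : SignedMeasure α, ∀ s (hs : MeasurableSet s),
      ν s = g ⟨_, indicator_one_mem_memLpSubmodule s hs⟩ := by
  classical
  have hq0 : 0 < q.toReal := ENNReal.toReal_pos (by positivity) hq
  let F : Set α → ℝ := fun s => if hs : MeasurableSet s then
    g ⟨_, indicator_one_mem_memLpSubmodule s hs⟩ else 0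
  have hF : ∀ s (hs : MeasurableSet s), F s = g ⟨_, indicator_one_mem_memLpSubmodule s hs⟩ :=
    fun s hs => dif_pos hs
  refine ⟨⟨F, ?_, fun s hs => dif_neg hs, ?_⟩, hF⟩
  · rw [hF ∅ MeasurableSet.empty]
    convert g.map_zero
    simp only [Set.indicator_empty]
    rfl
  · intro A hA hd
    have hU : MeasurableSet (⋃ i, A i) := MeasurableSet.iUnion hA
    have hR : ∀ S : Finset ℕ, MeasurableSet (⋃ i : {i // i ∉ S}, A i) := fun S =>
      MeasurableSet.iUnion fun i => hA i
    -- By additivity the error of a finite partial sum is `g` of the rest of the union.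
    have hsum : ∀ S : Finset ℕ, F (⋃ i, A i) - ∑ i ∈ S, F (A i)
        = g ⟨_, indicator_one_mem_memLpSubmodule _ (hR S)⟩ := by
      intro S
      rw [hF _ hU, Finset.sum_congr rfl fun i _ => hF _ (hA i), ← map_sum, ← map_sub]
      congr 1
      ext x
      simp only [AddSubgroupClass.coe_sub, Pi.sub_apply, AddSubmonoidClass.coe_finsetSum,
        Finset.sum_apply]
      by_cases hx : x ∈ ⋃ i, A i
      · obtain ⟨j, hj⟩ := Set.mem_iUnion.1 hx
        have huniq : ∀ i, x ∈ A i → i = j := fun i hi => by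
          by_contra hne
          exact Set.disjoint_left.1 (hd hne) hi hj
        rw [Set.indicator_of_mem hx]
        have h1 : ∀ i, (A i).indicator (fun _ => (1 : ℝ)) x = if i = j then 1 else 0 := by
          intro i
          by_cases hij : i = j
          · rw [hij, Set.indicator_of_mem hj, if_pos rfl]
          · rw [Set.indicator_of_notMem (fun h => hij (huniq i h)), if_neg hij]
        simp only [h1, Finset.sum_ite_eq']
        by_cases hjS : j ∈ S
        · rw [if_pos hjS, Set.indicator_of_notMem, sub_self]
          intro h
          obtain ⟨⟨i, hiS⟩, hi⟩ := Set.mem_iUnion.1 h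
          exact hiS (huniq i hi ▸ hjS)
        · rw [if_neg hjS, Set.indicator_of_mem, sub_zero]
          exact Set.mem_iUnion.2 ⟨⟨j, hjS⟩, hj⟩
      · have h1 : ∀ i, x ∉ A i := fun i hi => hx (Set.mem_iUnion.2 ⟨i, hi⟩)
        rw [Set.indicator_of_notMem hx, Set.indicator_of_notMem, zero_sub,
          Finset.sum_eq_zero fun i _ => Set.indicator_of_notMem (h1 i) _, neg_zero]
        intro h
        obtain ⟨i, hi⟩ := Set.mem_iUnion.1 h
        exact h1 i hi
    have hm : ∀ S : Finset ℕ, m (⋃ i : {i // i ∉ S}, A i) = ∑' i : {i // i ∉ S}, m (A i) :=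
      fun S => measure_iUnion (fun i j hij => hd (fun h => hij (Subtype.ext h))) fun i => hA i
    have hfin : ∑' i, m (A i) ≠ ⊤ := by
      rw [← measure_iUnion hd hA]; exact measure_ne_top _ _
    have hlim := ENNReal.tendsto_tsum_compl_atTop_zero hfin
    have hlim2 : Tendsto (fun S : Finset ℕ =>
        C * (m (⋃ i : {i // i ∉ S}, A i) ^ (1 / q.toReal)).toReal) atTop (𝓝 0) := by
      have h1 : Tendsto (fun S : Finset ℕ => m (⋃ i : {i // i ∉ S}, A i)) atTop (𝓝 0) := by
        simp only [hm]; exact hlim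
      have h2 := ((ENNReal.continuous_rpow_const (y := 1 / q.toReal)).tendsto 0).comp h1
      rw [ENNReal.zero_rpow_of_pos (by positivity)] at h2
      have h3 := ((ENNReal.tendsto_toReal ENNReal.zero_ne_top).comp h2).const_mul C
      simpa using h3
    have h4 : Tendsto (fun S : Finset ℕ => F (⋃ i, A i) - ∑ i ∈ S, F (A i)) atTop (𝓝 0) := by
      refine squeeze_zero_norm (fun S => ?_) hlim2
      rw [hsum S, Real.norm_eq_abs]
      exact abs_apply_indicator_le hq1 hq hg (hR S)
    have h5 := (tendsto_const_nhds (x := F (⋃ i, A i))).sub h4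
    simpa [HasSum] using h5

lemma simpleFunc_bounded (s : SimpleFunc α ℝ) : ∃ b, ∀ x, |s x| ≤ b := by
  obtain ⟨b, hb⟩ := s.exists_forall_norm_le
  exact ⟨b, hb⟩

lemma apply_simpleFunc_eq_integral {g : memLpSubmodule q m →ₗ[ℝ] ℝ} {f : α → ℝ}
    (hf : Integrable f m) (hind : ∀ s (hs : MeasurableSet s),
      g ⟨_, indicator_one_mem_memLpSubmodule s hs⟩ = ∫ x in s, f x ∂m) (s : SimpleFunc α ℝ)
    (hs : (s : α → ℝ) ∈ memLpSubmodule q m) : g ⟨s, hs⟩ = ∫ x, f x * s x ∂m := by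
  induction s using SimpleFunc.induction with
  | @const c A hA =>
    have h1 : (⟨_, hs⟩ : memLpSubmodule q m)
        = c • ⟨_, indicator_one_mem_memLpSubmodule A hA⟩ := by
      ext x
      by_cases hx : x ∈ A <;> simp [hx]
    rw [h1, map_smul, hind A hA, ← integral_indicator hA, smul_eq_mul, ← integral_const_mul]
    refine integral_congr_ae (Eventually.of_forall fun x => ?_)
    by_cases hx : x ∈ A <;> simp [hx, mul_comm]
  | @add s t hd h1 h2 =>
    have hs' := s.memLp_of_isFiniteMeasure q m
    have ht' := t.memLp_of_isFiniteMeasure q m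
    have h3 : (⟨_, hs⟩ : memLpSubmodule q m) = ⟨s, hs'⟩ + ⟨t, ht'⟩ := rfl
    rw [h3, map_add, h1 hs', h2 ht', ← integral_add
      (integrable_mul_of_bounded hf s.measurable (simpleFunc_bounded s))
      (integrable_mul_of_bounded hf t.measurable (simpleFunc_bounded t))]
    refine integral_congr_ae (Eventually.of_forall fun x => ?_)
    simp [mul_add]

/-- A bounded functional on `L^q` of a finite measure is, on bounded functions, the integral against
an integrable density: the Radon-Nikodym derivative of `A ↦ g(1_A)`. -/
lemma exists_density (hq1 : 1 ≤ q) (hq : q ≠ ⊤) (g : memLpSubmodule q m →ₗ[ℝ] ℝ) {C : ℝ}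
    (hg : ∀ f, |g f| ≤ C * (eLpNorm (f : α → ℝ) q m).toReal) :
    ∃ f : α → ℝ, Integrable f m ∧ ∀ (ψ : α → ℝ) (hψ : ψ ∈ memLpSubmodule q m), Measurable ψ →
      (∃ b, ∀ x, |ψ x| ≤ b) → g ⟨ψ, hψ⟩ = ∫ x, f x * ψ x ∂m := by
  have hq0 : 0 < q.toReal := ENNReal.toReal_pos (by positivity) hq
  obtain ⟨ν, hν⟩ := exists_signedMeasure hq1 hq g hg
  have hac : ν ≪ᵥ m.toENNRealVectorMeasure := by
    refine VectorMeasure.AbsolutelyContinuous.mk fun s hs h0 => ?_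
    rw [Measure.toENNRealVectorMeasure_apply_measurable hs] at h0
    have := abs_apply_indicator_le hq1 hq hg hs
    rw [h0, ENNReal.zero_rpow_of_pos (by positivity)] at this
    rw [hν s hs]
    exact abs_nonpos_iff.1 (by simpa using this)
  have hrn := (SignedMeasure.absolutelyContinuous_iff_withDensityᵥ_rnDeriv_eq ν m).1 hac
  set f := ν.rnDeriv m with hf
  have hfi : Integrable f m := SignedMeasure.integrable_rnDeriv ν m
  have hind : ∀ s (hs : MeasurableSet s),
      g ⟨_, indicator_one_mem_memLpSubmodule s hs⟩ = ∫ x in s, f x ∂m := by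
    intro s hs
    rw [← hν s hs, ← hrn, withDensityᵥ_apply hfi hs]
  refine ⟨f, hfi, fun ψ hψ hψm ⟨b, hb⟩ => ?_⟩
  set s : ℕ → SimpleFunc α ℝ := fun k =>
    SimpleFunc.approxOn ψ hψm (Set.range ψ ∪ {0}) 0 (by simp) k with hs
  have hmem : ∀ k, (s k : α → ℝ) ∈ memLpSubmodule q m := fun k =>
    (s k).memLp_of_isFiniteMeasure q m
  have hL : Tendsto (fun k => eLpNorm (⇑(s k) - ψ) q m) atTop (𝓝 0) :=
    SimpleFunc.tendsto_approxOn_range_Lp_eLpNorm hq hψm hψ.2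
  have hg1 : Tendsto (fun k => g ⟨s k, hmem k⟩) atTop (𝓝 (g ⟨ψ, hψ⟩)) := by
    rw [tendsto_iff_norm_sub_tendsto_zero]
    have h1 := ((ENNReal.tendsto_toReal ENNReal.zero_ne_top).comp hL).const_mul C
    simp only [ENNReal.toReal_zero, mul_zero] at h1
    refine squeeze_zero (fun _ => norm_nonneg _) (fun k => ?_) h1
    rw [← map_sub]
    exact hg _
  have hg2 : Tendsto (fun k => ∫ x, f x * s k x ∂m) atTop (𝓝 (∫ x, f x * ψ x ∂m)) := by
    refine tendsto_integral_of_dominated_convergence (fun x => |f x| * (b + b))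
      (fun k => (integrable_mul_of_bounded hfi (s k).measurable
        (simpleFunc_bounded _)).aestronglyMeasurable)
      (hfi.abs.mul_const _) (fun k => Eventually.of_forall fun x => ?_)
      (Eventually.of_forall fun x => ?_)
    · rw [norm_mul, Real.norm_eq_abs]
      gcongr
      refine (SimpleFunc.norm_approxOn_zero_le hψm _ x k).trans ?_
      exact add_le_add (hb x) (hb x)
    · refine Tendsto.const_mul _ (SimpleFunc.tendsto_approxOn hψm _ (subset_closure ?_))
      simp
  refine tendsto_nhds_unique hg1 (hg2.congr fun k => 
    (apply_simpleFunc_eq_integral hfi hind (s k) (hmem k)).symm)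

end density

/-! ### The weak gradient for `p > 1` -/

/-- A continuous positive weight of finite mass, bounded by `1`. -/
def weight (N : ℕ) (x : E N) : ℝ := (1 + ‖x‖) ^ (-((N : ℝ) + 1))

section weight

variable {N : ℕ}

lemma weight_pos (x : E N) : 0 < weight N x := by unfold weight; positivity

lemma weight_le_one (x : E N) : weight N x ≤ 1 :=
  Real.rpow_le_one_of_one_le_of_nonpos (by linarith [norm_nonneg x])
    (by have : (0 : ℝ) ≤ N := by positivity
        linarith)

lemma continuous_weight : Continuous (weight N) := by
  unfold weight
  refine Continuous.rpow_const (by fun_prop) fun x => Or.inl ?_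
  have := norm_nonneg x
  positivity

lemma integrable_weight : Integrable (weight N) :=
  integrable_one_add_norm (by simp)

/-- The finite measure with density `weight N`. -/
def weightMeasure (N : ℕ) : Measure (E N) :=
  volume.withDensity fun x => ENNReal.ofReal (weight N x)

instance : IsFiniteMeasure (weightMeasure N) :=
  isFiniteMeasure_withDensity_ofReal integrable_weight.2

lemma measurable_ofReal_weight : Measurable fun x : E N => ENNReal.ofReal (weight N x) :=
  continuous_weight.measurable.ennreal_ofReal

lemma integral_weightMeasure (f : E N → ℝ) :
    ∫ x, f x ∂(weightMeasure N) = ∫ x, weight N x * f x := by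
  rw [weightMeasure, integral_withDensity_eq_integral_toReal_smul measurable_ofReal_weight
    (Eventually.of_forall fun _ => ENNReal.ofReal_lt_top)]
  refine integral_congr_ae (Eventually.of_forall fun x => ?_)
  simp [ENNReal.toReal_ofReal (weight_pos x).le]

lemma locallyIntegrable_of_integrable_weightMeasure {f : E N → ℝ}
    (hf : Integrable f (weightMeasure N)) : LocallyIntegrable f := by
  rw [weightMeasure, integrable_withDensity_iff_integrable_smul' measurable_ofReal_weight
    (Eventually.of_forall fun _ => ENNReal.ofReal_lt_top)] at hf
  have hc : Continuous fun x : E N => (weight N x)⁻¹ :=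
    continuous_weight.inv₀ fun x => (weight_pos x).ne'
  refine (hf.locallyIntegrable.mul_continuous hc).congr (Eventually.of_forall fun x => ?_)
  have := (weight_pos x).ne'
  simp only [ENNReal.toReal_ofReal (weight_pos x).le, smul_eq_mul]
  field_simp

lemma eLpNorm_weight_mul_le {q : ℝ} (hq : 1 ≤ q) {ψ : E N → ℝ} (hψ : Measurable ψ) :
    eLpNorm (fun x => weight N x * ψ x) (ENNReal.ofReal q) volume
      ≤ eLpNorm ψ (ENNReal.ofReal q) (weightMeasure N) := by
  have hq0 : 0 < q := by linarith
  rw [eLpNorm_eq_lintegral_rpow_enorm_toReal (by simpa using hq0) ENNReal.ofReal_ne_top,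
    eLpNorm_eq_lintegral_rpow_enorm_toReal (by simpa using hq0) ENNReal.ofReal_ne_top,
    ENNReal.toReal_ofReal hq0.le, weightMeasure,
    lintegral_withDensity_eq_lintegral_mul _ measurable_ofReal_weight (by fun_prop)]
  refine ENNReal.rpow_le_rpow (lintegral_mono fun x => ?_) (by positivity)
  simp only [Pi.mul_apply]
  rw [enorm_mul, ENNReal.mul_rpow_of_nonneg _ _ hq0.le, Real.enorm_of_nonneg (weight_pos x).le]
  gcongr
  calc ENNReal.ofReal (weight N x) ^ q ≤ ENNReal.ofReal (weight N x) ^ (1 : ℝ) :=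
        ENNReal.rpow_le_rpow_of_exponent_ge
          (by simpa using ENNReal.ofReal_le_ofReal (weight_le_one x)) hq
    _ = _ := ENNReal.rpow_one _

end weight

section weakGradient

variable {N : ℕ} {u : E N → ℝ}

lemma enorm_fderiv_single_le (v : E N → ℝ) (x : E N) (i : Fin N) :
    ‖fderiv ℝ v x (EuclideanSpace.single i 1)‖ₑ ≤ ‖gradient v x‖ₑ := by
  rw [← ofReal_norm, ← ofReal_norm, norm_gradient]
  refine ENNReal.ofReal_le_ofReal ((ContinuousLinearMap.le_opNorm _ _).trans ?_)
  simp

/-- The distributional derivative is bounded in the dual exponent by the gradients of the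
mollifications. -/
lemma abs_integral_mul_fderiv_le (hu : LocallyIntegrable u) {p q : ℝ} (hpq : p.HolderConjugate q)
    {C : ℝ≥0∞} (hCtop : C ≠ ⊤) (hC : ∀ n, ∫⁻ x, ‖gradient (mollify n u) x‖ₑ ^ p ≤ C)
    {φ : E N → ℝ} (hφ : ContDiff ℝ ∞ φ) (hc : HasCompactSupport φ) (i : Fin N) :
    |∫ x, u x * fderiv ℝ φ x (EuclideanSpace.single i 1)|
      ≤ (C ^ (1 / p)).toReal * (eLpNorm φ (ENNReal.ofReal q) volume).toReal := by
  have hp0 := hpq.pos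
  have hq0 := hpq.symm.pos
  have hfin : eLpNorm φ (ENNReal.ofReal q) volume ≠ ⊤ :=
    (hφ.continuous.memLp_of_hasCompactSupport hc).2.ne
  have hlim := (tendsto_integral_mollify_mul hu (continuous_fderiv_apply hφ
    (EuclideanSpace.single i 1)) (hasCompactSupport_fderiv_apply hc _)).abs
  refine le_of_tendsto' hlim fun n => ?_
  rw [integral_mul_fderiv_eq_neg (mollify_contDiff n hu) hφ hc, abs_neg, ← ENNReal.toReal_mul,
    ← Real.norm_eq_abs, ← toReal_enorm]
  refine ENNReal.toReal_mono (ENNReal.mul_ne_top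
    (ENNReal.rpow_ne_top_of_nonneg (by positivity) hCtop) hfin) ?_
  refine (enorm_integral_le_lintegral_enorm _).trans ?_
  have hm : Measurable fun x => fderiv ℝ (mollify n u) x (EuclideanSpace.single i 1) :=
    (continuous_fderiv_apply (mollify_contDiff n hu) _).measurable
  have h1 := ENNReal.lintegral_mul_le_Lp_mul_Lq volume hpq
    (f := fun x => ‖fderiv ℝ (mollify n u) x (EuclideanSpace.single i 1)‖ₑ) (g := fun x => ‖φ x‖ₑ)
    hm.enorm.aemeasurable hφ.continuous.measurable.enorm.aemeasurable
  simp only [enorm_mul]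
  refine h1.trans ?_
  rw [eLpNorm_eq_lintegral_rpow_enorm_toReal (by simpa using hq0) ENNReal.ofReal_ne_top,
    ENNReal.toReal_ofReal hq0.le]
  gcongr
  refine le_trans (lintegral_mono fun x => ?_) (hC n)
  exact ENNReal.rpow_le_rpow (enorm_fderiv_single_le _ _ _) hp0.le

/-- The functions `ψ` for which `weight * ψ` is a test function. -/
def weightedTestFunctions (N : ℕ) (q : ℝ≥0∞) :
    Submodule ℝ (memLpSubmodule q (weightMeasure N)) where
  carrier := {ψ | ContDiff ℝ ∞ (fun x => weight N x * (ψ : E N → ℝ) x) ∧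
    HasCompactSupport (fun x => weight N x * (ψ : E N → ℝ) x)}
  add_mem' := by
    rintro a b ⟨ha, ha'⟩ ⟨hb, hb'⟩
    have h1 : (fun x => weight N x * ((a + b : memLpSubmodule q (weightMeasure N)) : E N → ℝ) x)
        = (fun x => weight N x * (a : E N → ℝ) x) + fun x => weight N x * (b : E N → ℝ) x := by
      ext x; simp [mul_add]
    simp only [Set.mem_ofPred_eq, h1]
    exact ⟨ha.add hb, ha'.add hb'⟩
  zero_mem' := by
    simp only [Set.mem_ofPred_eq, ZeroMemClass.coe_zero, Pi.zero_apply, mul_zero]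
    exact ⟨contDiff_const, HasCompactSupport.zero⟩
  smul_mem' := by
    rintro c a ⟨ha, ha'⟩
    have h1 : (fun x => weight N x * ((c • a : memLpSubmodule q (weightMeasure N)) : E N → ℝ) x)
        = fun x => c * (weight N x * (a : E N → ℝ) x) := by
      ext x; simp; ring
    simp only [Set.mem_ofPred_eq, h1]
    exact ⟨contDiff_const.mul ha, ha'.mul_left⟩

/-- The distributional partial derivative of `u`, as a functional on weighted test functions. -/
def weightedDerivative (hu : LocallyIntegrable u) (q : ℝ≥0∞) (i : Fin N) :
    memLpSubmodule q (weightMeasure N) →ₗ.[ℝ] ℝ where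
  domain := weightedTestFunctions N q
  toFun :=
    { toFun := fun ψ => ∫ x, u x *
        fderiv ℝ (fun x => weight N x * (ψ : E N → ℝ) x) x (EuclideanSpace.single i 1)
      map_add' := by
        rintro ⟨a, ha, ha'⟩ ⟨b, hb, hb'⟩
        rw [← integral_add (integrable_mul_of_hasCompactSupport hu (continuous_fderiv_apply ha _)
            (hasCompactSupport_fderiv_apply ha' _))
          (integrable_mul_of_hasCompactSupport hu (continuous_fderiv_apply hb _)
            (hasCompactSupport_fderiv_apply hb' _))]
        refine integral_congr_ae (Eventually.of_forall fun x => ?_)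
        have h1 : (fun x => weight N x * ((a + b : memLpSubmodule q (weightMeasure N)) : E N → ℝ) x)
            = (fun x => weight N x * (a : E N → ℝ) x) + fun x => weight N x * (b : E N → ℝ) x := by
          ext x; simp [mul_add]
        change u x * fderiv ℝ (fun x => weight N x *
          ((a + b : memLpSubmodule q (weightMeasure N)) : E N → ℝ) x) x _ = _
        rw [h1, fderiv_add (ha.differentiable (by simp) x) (hb.differentiable (by simp) x)]
        simp [mul_add]
      map_smul' := by
        rintro c ⟨a, ha, ha'⟩
        rw [RingHom.id_apply, smul_eq_mul, ← integral_const_mul]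
        refine integral_congr_ae (Eventually.of_forall fun x => ?_)
        have h1 : (fun x => weight N x * ((c • a : memLpSubmodule q (weightMeasure N)) : E N → ℝ) x)
            = fun x => c * (weight N x * (a : E N → ℝ) x) := by
          ext x; simp; ring
        change u x * fderiv ℝ (fun x => weight N x *
          ((c • a : memLpSubmodule q (weightMeasure N)) : E N → ℝ) x) x _ = _
        rw [h1, fderiv_const_mul (ha.differentiable (by simp) x)]
        simp; ring }

/-- If the gradients of the mollifications are bounded in `L^p` with `p > 1`, the distributional
partial derivatives are locally integrable functions. -/
lemma exists_weak_partial_derivative (hu : LocallyIntegrable u) {p : ℝ} (hp : 1 < p)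
    {C : ℝ≥0∞} (hCtop : C ≠ ⊤) (hC : ∀ n, ∫⁻ x, ‖gradient (mollify n u) x‖ₑ ^ p ≤ C) (i : Fin N) :
    ∃ f : E N → ℝ, LocallyIntegrable f ∧ ∀ φ : E N → ℝ, ContDiff ℝ ∞ φ → HasCompactSupport φ →
      ∫ x, u x * fderiv ℝ φ x (EuclideanSpace.single i 1) = ∫ x, f x * φ x := by
  set q : ℝ := p.conjExponent with hqdef
  have hpq : p.HolderConjugate q := Real.HolderConjugate.conjExponent hp
  have hq1 : 1 < q := hpq.symm.lt
  set Q : ℝ≥0∞ := ENNReal.ofReal q with hQ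
  have hQ1 : 1 ≤ Q := by rw [hQ]; simpa using hq1.le
  set c := (C ^ (1 / p)).toReal with hc
  have hc0 : 0 ≤ c := ENNReal.toReal_nonneg
  -- The weight is at most `1`, so `ψ ↦ weight * ψ` does not increase the `L^q` norm from
  -- `weightMeasure N` to Lebesgue measure, and Hahn-Banach applies on `L^q` of a finite measure.
  obtain ⟨g, hg1, hg2⟩ := exists_extension_of_le_sublinear (weightedDerivative hu Q i)
    (fun ψ => c * (eLpNorm (ψ : E N → ℝ) Q (weightMeasure N)).toReal)
    (by
      intro a ha ψ
      simp only [SetLike.val_smul]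
      rw [eLpNorm_const_smul, ENNReal.toReal_mul, toReal_enorm, Real.norm_of_nonneg ha.le]
      ring)
    (by
      intro ψ χ
      rw [← mul_add, ← ENNReal.toReal_add ψ.2.2.ne χ.2.2.ne]
      gcongr
      · exact (ENNReal.add_lt_top.2 ⟨ψ.2.2, χ.2.2⟩).ne
      · exact eLpNorm_add_le ψ.2.1 χ.2.1 hQ1)
    (by
      rintro ⟨⟨ψ, hψ⟩, hψ1, hψ2⟩
      refine (le_abs_self _).trans ((abs_integral_mul_fderiv_le hu hpq hCtop hC hψ1 hψ2 i).trans ?_)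
      gcongr
      · exact hψ.2.ne
      · have hm : Measurable ψ := by
          have h1 : ψ = fun x => (weight N x)⁻¹ * (weight N x * ψ x) := by
            ext x; have := (weight_pos x).ne'; field_simp
          rw [h1]
          exact continuous_weight.measurable.inv.mul hψ1.continuous.measurable
        exact eLpNorm_weight_mul_le hq1.le hm)
  have hgb : ∀ ψ, |g ψ| ≤ c * (eLpNorm (ψ : E N → ℝ) Q (weightMeasure N)).toReal := by
    intro ψ
    rw [abs_le']
    refine ⟨hg2 ψ, ?_⟩
    rw [← map_neg]
    refine (hg2 (-ψ)).trans (le_of_eq ?_)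
    rw [NegMemClass.coe_neg, eLpNorm_neg]
  obtain ⟨f, hf, hfg⟩ := exists_density hQ1 ENNReal.ofReal_ne_top g hgb
  refine ⟨f, locallyIntegrable_of_integrable_weightMeasure hf, fun φ hφ hφc => ?_⟩
  set ψ : E N → ℝ := fun x => (weight N x)⁻¹ * φ x with hψ
  have hψc : Continuous ψ :=
    (continuous_weight.inv₀ fun x => (weight_pos x).ne').mul hφ.continuous
  have hψs : HasCompactSupport ψ := hφc.mul_left
  have hψm : ψ ∈ memLpSubmodule Q (weightMeasure N) := by
    obtain ⟨b, hb⟩ := hψs.exists_bound_of_continuous hψc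
    exact MemLp.of_bound hψc.aestronglyMeasurable b (Eventually.of_forall hb)
  have hWψ : (fun x => weight N x * ψ x) = φ := by
    ext x; have := (weight_pos x).ne'; simp only [hψ]; field_simp
  have hdom : (⟨ψ, hψm⟩ : memLpSubmodule Q (weightMeasure N)) ∈ weightedTestFunctions N Q := by
    change ContDiff ℝ ∞ (fun x => weight N x * ψ x) ∧ HasCompactSupport (fun x => weight N x * ψ x)
    rw [hWψ]; exact ⟨hφ, hφc⟩
  have h1 := hg1 ⟨_, hdom⟩
  have h2 : (weightedDerivative hu Q i) ⟨_, hdom⟩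
      = ∫ x, u x * fderiv ℝ φ x (EuclideanSpace.single i 1) := by
    change ∫ x, u x * fderiv ℝ (fun x => weight N x * ψ x) x _ = _
    rw [hWψ]
  rw [← h2, ← h1, hfg ψ hψm hψc.measurable (by
    obtain ⟨b, hb⟩ := hψs.exists_bound_of_continuous hψc
    exact ⟨b, hb⟩), integral_weightMeasure]
  refine integral_congr_ae (Eventually.of_forall fun x => ?_)
  have := (weight_pos x).ne'
  simp only [hψ]
  field_simp

end weakGradient

section weakGradientEnergy

variable {N : ℕ} {u : E N → ℝ}

lemma fderiv_mollify_apply (n : ℕ) (hu : LocallyIntegrable u) (x y : E N) :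
    fderiv ℝ (mollify n u) x y = ∫ t, u t * fderiv ℝ (mollifier N n) (x - t) y := by
  rw [fderiv_mollify_eq_convolution n hu, ContinuousLinearMap.integral_apply
    (integrable_fderiv_mollifier_precompL n hu x), ← integral_sub_left_eq_self _ _ x]
  refine integral_congr_ae (Eventually.of_forall fun t => ?_)
  simp [mul_comm]

/-- Differentiation commutes with mollification. -/
lemma fderiv_mollify_eq_mollify (n : ℕ) (hu : LocallyIntegrable u) {g : E N → E N}
    (hg : IsWeakGradient u g) (x : E N) (i : Fin N) :
    fderiv ℝ (mollify n u) x (EuclideanSpace.single i 1) = mollify n (fun t => g t i) x := by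
  have hs : ContDiff ℝ ∞ fun t => mollifier N n (x - t) :=
    (mollifier_contDiff n).comp (contDiff_const.sub contDiff_id)
  have hc : HasCompactSupport fun t => mollifier N n (x - t) :=
    (mollifier_hasCompactSupport n).comp_homeomorph (Homeomorph.subLeft x)
  have h1 := hg.2 _ hs hc i
  have h2 : ∀ t, fderiv ℝ (fun t => mollifier N n (x - t)) t (EuclideanSpace.single i 1)
      = -fderiv ℝ (mollifier N n) (x - t) (EuclideanSpace.single i 1) := by
    intro t
    have hd : DifferentiableAt ℝ (mollifier N n) (x - t) :=
      (mollifier_contDiff n).differentiable (by simp) _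
    have h3 : HasFDerivAt (fun t => mollifier N n (x - t)) _ t :=
      hd.hasFDerivAt.comp t ((hasFDerivAt_id t).const_sub x)
    rw [h3.fderiv]; simp
  simp only [h2, mul_neg, integral_neg, neg_inj] at h1
  rw [fderiv_mollify_apply n hu, h1, mollify_apply_swap]
  refine integral_congr_ae (Eventually.of_forall fun t => ?_)
  simp [mul_comm]

lemma locallyIntegrable_coord {g : E N → E N} (hg : LocallyIntegrable g) (i : Fin N) :
    LocallyIntegrable fun x => g x i := by
  intro x
  obtain ⟨s, hs, hi⟩ := hg x
  exact ⟨s, hs, (EuclideanSpace.proj (𝕜 := ℝ) i).integrable_comp hi⟩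

lemma ae_tendsto_gradient_mollify (hu : LocallyIntegrable u) {g : E N → E N}
    (hg : IsWeakGradient u g) :
    ∀ᵐ x, Tendsto (fun n => gradient (mollify n u) x) atTop (𝓝 (g x)) := by
  have h1 : ∀ᵐ x, ∀ i : Fin N, Tendsto (fun n => mollify n (fun t => g t i) x) atTop
      (𝓝 (g x i)) := ae_all_iff.2 fun i => ae_tendsto_mollify (locallyIntegrable_coord hg.1 i)
  filter_upwards [h1] with x hx
  have h2 : Tendsto (fun n => (WithLp.ofLp (gradient (mollify n u) x))) atTop
      (𝓝 (WithLp.ofLp (g x))) := by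
    rw [tendsto_pi_nhds]
    intro i
    refine (hx i).congr fun n => ?_
    rw [gradient_coord, fderiv_mollify_eq_mollify n hu hg]
  exact ((PiLp.continuous_toLp 2 (fun _ : Fin N => ℝ)).tendsto _).comp h2

lemma measurable_enorm_gradient (v : E N → ℝ) : Measurable fun x => ‖gradient v x‖ₑ := by
  simp only [enorm_gradient]
  exact (measurable_fderiv ℝ v).enorm

lemma lintegral_weakGradient_le (hu : LocallyIntegrable u) {g : E N → E N}
    (hg : IsWeakGradient u g) {p : ℝ} {C : ℝ≥0∞}
    (hC : ∀ n, ∫⁻ x, ‖gradient (mollify n u) x‖ₑ ^ p ≤ C) : ∫⁻ x, ‖g x‖ₑ ^ p ≤ C := by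
  calc ∫⁻ x, ‖g x‖ₑ ^ p
      = ∫⁻ x, liminf (fun n => ‖gradient (mollify n u) x‖ₑ ^ p) atTop := by
        refine lintegral_congr_ae ?_
        filter_upwards [ae_tendsto_gradient_mollify hu hg] with x hx
        exact (((ENNReal.continuous_rpow_const.tendsto _).comp
          ((continuous_enorm.tendsto _).comp hx)).liminf_eq).symm
    _ ≤ liminf (fun n => ∫⁻ x, ‖gradient (mollify n u) x‖ₑ ^ p) atTop :=
        lintegral_liminf_le fun n => (measurable_enorm_gradient _).pow_const _
    _ ≤ C := liminf_le_of_le (by isBoundedDefault) fun b hb => by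
        obtain ⟨k, hk⟩ := hb.exists
        exact hk.trans (hC k)

lemma exists_isWeakGradient (hu : LocallyIntegrable u) {p : ℝ} (hp : 1 < p) {C : ℝ≥0∞}
    (hCtop : C ≠ ⊤) (hC : ∀ n, ∫⁻ x, ‖gradient (mollify n u) x‖ₑ ^ p ≤ C) :
    ∃ g : E N → E N, IsWeakGradient u g ∧ ∫⁻ x, ‖g x‖ₑ ^ p ≤ C := by
  choose f hf hfφ using fun i => exists_weak_partial_derivative hu hp hCtop hC i
  have hg : IsWeakGradient u fun x => ∑ i, (-f i x) • EuclideanSpace.single i (1 : ℝ) := by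
    refine ⟨?_, fun φ hφ hc i => ?_⟩
    · refine locallyIntegrable_finsetSum _ fun i _ => ?_
      exact (hf i).neg.smul_continuous continuous_const
    · rw [hfφ i φ hφ hc, ← integral_neg]
      refine integral_congr_ae (Eventually.of_forall fun x => ?_)
      simp [Finset.sum_apply, Pi.single_apply]
  exact ⟨_, hg, lintegral_weakGradient_le hu hg hC⟩

/-- The functional `Φ` is bounded by any common bound of the `L^p` energies of the
mollifications. -/
lemma Phi_le_of_mollify (hu : LocallyIntegrable u) {p : ℝ} (hp : 1 ≤ p) {C : ℝ≥0∞}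
    (hC : ∀ n, ∫⁻ x, ‖gradient (mollify n u) x‖ₑ ^ p ≤ C) : Phi p u ≤ C := by
  unfold Phi
  split_ifs with h1
  · refine totalVariation_le_of_mollify hu fun n => ?_
    simpa [h1] using hC n
  · by_cases hCtop : C = ⊤
    · rw [hCtop]; exact le_top
    obtain ⟨g, hg, hgC⟩ := exists_isWeakGradient hu (lt_of_le_of_ne hp (Ne.symm h1)) hCtop hC
    exact (iInf₂_le g hg).trans hgC

end weakGradientEnergy

/-! ### The lower bound of the upper limit -/

theorem mul_Phi_le_limsup {N : ℕ} (hN : 1 ≤ N) {e : E N} (he : ‖e‖ = 1) {u : E N → ℝ}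
    (hu : LocallyIntegrable u) {p γ : ℝ} (hp : 1 ≤ p) (hγ : 0 < γ) :
    ENNReal.ofReal (sphereConst N p e / (γ + p)) * Phi p u
      ≤ limsup (fun l : ℝ => PhiL p γ u l) atTop := by
  set κ := ENNReal.ofReal (sphereConst N p e / (γ + p)) with hκ
  have hκ0 : κ ≠ 0 := by
    have h1 := sphereConst_pos (p := p) (by linarith) he
    have : 0 < sphereConst N p e / (γ + p) := div_pos h1 (by linarith)
    simpa [hκ] using this
  rw [mul_comm]
  refine ENNReal.mul_le_of_le_div (Phi_le_of_mollify hu hp fun n => ?_)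
  rw [ENNReal.le_div_iff_mul_le (Or.inl hκ0) (Or.inl ENNReal.ofReal_ne_top), mul_comm]
  exact gradient_mollify_bound hN he hu hp hγ n

lemma Phi_lt_top {N : ℕ} (hN : 1 ≤ N) {e : E N} (he : ‖e‖ = 1) {u : E N → ℝ}
    (hu : LocallyIntegrable u) {p γ : ℝ} (hp : 1 ≤ p) (hγ : 0 < γ)
    (hlim : limsup (fun l : ℝ => PhiL p γ u l) atTop < ⊤) : Phi p u < ⊤ := by
  have h1 := (mul_Phi_le_limsup hN he hu hp hγ).trans_lt hlim
  have hκ : 0 < sphereConst N p e / (γ + p) :=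
    div_pos (sphereConst_pos (p := p) (by linarith) he) (by linarith)
  by_contra h
  rw [not_lt_top_iff.1 h, ENNReal.mul_top (by simpa using hκ)] at h1
  exact lt_irrefl _ h1

lemma memSobolev_of_Phi_lt_top {N : ℕ} {u : E N → ℝ} {p : ℝ} (hp : 1 < p)
    (hu : MemLp u (ENNReal.ofReal p)) (h : Phi p u < ⊤) : MemSobolev p u := by
  refine ⟨hu, ?_⟩
  rw [Phi, if_neg hp.ne'] at h
  obtain ⟨g, hg⟩ := iInf_lt_iff.1 h
  obtain ⟨hgw, hgf⟩ := iInf_lt_iff.1 hg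
  have hp0 : 0 < p := by linarith
  refine ⟨g, hgw, hgw.1.aestronglyMeasurable, ?_⟩
  rw [eLpNorm_lt_top_iff_lintegral_rpow_enorm_lt_top (by simpa using hp0) ENNReal.ofReal_ne_top,
    ENNReal.toReal_ofReal hp0.le]
  exact hgf

/-! ### Total variation and smooth functions -/

section smoothVariation

variable {N : ℕ}

/-- A smooth cutoff, equal to `1` on the ball of radius `k + 1`. -/
def cutoff (N k : ℕ) : ContDiffBump (0 : E N) where
  rIn := (k : ℝ) + 1
  rOut := (k : ℝ) + 2
  rIn_pos := by positivity
  rIn_lt_rOut := by linarith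

/-- A regularisation of the unit field `∇v / |∇v|`, cut off to have compact support. -/
def testField (v : E N → ℝ) (k : ℕ) (x : E N) : E N :=
  (cutoff N k x / √(‖gradient v x‖ ^ 2 + 1 / ((k : ℝ) + 1))) • gradient v x

lemma contDiff_gradient {v : E N → ℝ} (hv : ContDiff ℝ ∞ v) : ContDiff ℝ ∞ (gradient v) := by
  have h1 : ContDiff ℝ ∞ (fderiv ℝ v) := hv.fderiv_right (by simp)
  exact (InnerProductSpace.toDual ℝ (E N)).symm.contDiff.comp h1

lemma testField_denominator_pos (v : E N → ℝ) (k : ℕ) (x : E N) :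
    0 < ‖gradient v x‖ ^ 2 + 1 / ((k : ℝ) + 1) := by positivity

lemma contDiff_testField {v : E N → ℝ} (hv : ContDiff ℝ ∞ v) (k : ℕ) :
    ContDiff ℝ ∞ (testField v k) := by
  have h1 := contDiff_gradient hv
  have h2 : ContDiff ℝ ∞ fun x => √(‖gradient v x‖ ^ 2 + 1 / ((k : ℝ) + 1)) :=
    ((h1.norm_sq ℝ).add contDiff_const).sqrt fun x => (testField_denominator_pos v k x).ne'
  refine ContDiff.smul ((cutoff N k).contDiff.div h2 fun x => ?_) h1
  exact (Real.sqrt_pos.2 (testField_denominator_pos v k x)).ne'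

lemma hasCompactSupport_testField (v : E N → ℝ) (k : ℕ) : HasCompactSupport (testField v k) := by
  refine HasCompactSupport.smul_right (f := fun x => cutoff N k x / _) ?_
  simp only [div_eq_mul_inv]
  exact (cutoff N k).hasCompactSupport.mul_right

lemma norm_testField_le (v : E N → ℝ) (k : ℕ) (x : E N) : ‖testField v k x‖ ≤ 1 := by
  have h0 := Real.sqrt_pos.2 (testField_denominator_pos v k x)
  rw [testField, norm_smul, Real.norm_eq_abs, abs_div, abs_of_nonneg (cutoff N k).nonneg,
    abs_of_pos h0, div_mul_eq_mul_div, div_le_one h0]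
  refine (mul_le_of_le_one_left (norm_nonneg _) (cutoff N k).le_one).trans ?_
  refine Real.le_sqrt_of_sq_le ?_
  have : (0 : ℝ) ≤ 1 / ((k : ℝ) + 1) := by positivity
  linarith

lemma inner_testField (v : E N → ℝ) (k : ℕ) (x : E N) : inner ℝ (gradient v x) (testField v k x)
    = cutoff N k x * (‖gradient v x‖ ^ 2 / √(‖gradient v x‖ ^ 2 + 1 / ((k : ℝ) + 1))) := by
  rw [testField, real_inner_smul_right, real_inner_self_eq_norm_sq]; ring

lemma inner_testField_nonneg (v : E N → ℝ) (k : ℕ) (x : E N) :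
    0 ≤ inner ℝ (gradient v x) (testField v k x) := by
  rw [inner_testField]
  exact mul_nonneg (cutoff N k).nonneg (by positivity)

lemma tendsto_inner_testField (v : E N → ℝ) (x : E N) :
    Tendsto (fun k => inner ℝ (gradient v x) (testField v k x)) atTop (𝓝 ‖gradient v x‖) := by
  set a := ‖gradient v x‖ with ha
  have h1 : Tendsto (fun k : ℕ => a ^ 2 / √(a ^ 2 + 1 / ((k : ℝ) + 1))) atTop (𝓝 a) := by
    by_cases h0 : a = 0
    · simp [h0]
    have ha0 : 0 < a := lt_of_le_of_ne (norm_nonneg _) (Ne.symm h0)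
    have h2 : Tendsto (fun k : ℕ => √(a ^ 2 + 1 / ((k : ℝ) + 1))) atTop (𝓝 a) := by
      have h3 := (tendsto_one_div_add_atTop_nhds_zero_nat (𝕜 := ℝ)).const_add (a ^ 2)
      have h4 := (Real.continuous_sqrt.tendsto _).comp h3
      rwa [add_zero, Real.sqrt_sq ha0.le] at h4
    have h5 := (tendsto_const_nhds (x := a ^ 2)).div h2 h0
    rwa [sq, mul_div_cancel_right₀ _ h0, ← sq] at h5
  refine h1.congr' ?_
  filter_upwards [eventually_ge_atTop ⌈‖x‖⌉₊] with k hk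
  have h2 : ‖x‖ ≤ (k : ℝ) + 1 := by
    have := Nat.ceil_le.1 hk; linarith
  rw [inner_testField, (cutoff N k).one_of_mem_closedBall (by simpa [cutoff] using h2), one_mul]

/-- For a smooth function the gradient energy is bounded by the total variation. -/
lemma lintegral_gradient_le_totalVariation {v : E N → ℝ} (hv : ContDiff ℝ ∞ v) :
    ∫⁻ x, ‖gradient v x‖ₑ ≤ totalVariation v := by
  have hg := contDiff_gradient hv
  have hcont : ∀ k, Continuous fun x => inner ℝ (gradient v x) (testField v k x) := fun k =>
    hg.continuous.inner (contDiff_testField hv k).continuous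
  have hk : ∀ k, ∫⁻ x, ENNReal.ofReal (inner ℝ (gradient v x) (testField v k x))
      ≤ totalVariation v := by
    intro k
    have hi : Integrable fun x => inner ℝ (gradient v x) (testField v k x) := by
      refine (hcont k).integrable_of_hasCompactSupport ?_
      refine (hasCompactSupport_testField v k).mono fun x hx => ?_
      contrapose! hx
      simp only [Function.notMem_support] at hx ⊢
      rw [hx, inner_zero_right]
    rw [← ofReal_integral_eq_lintegral_ofReal hi (Eventually.of_forall fun x =>
      inner_testField_nonneg v k x)]
    refine le_trans ?_ (le_iSup₂ (f := fun (φ : E N → E N) (_ : φ ∈ {φ : E N → E N |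
      ContDiff ℝ ∞ φ ∧ HasCompactSupport φ ∧ ∀ x, ‖φ x‖ ≤ 1}) =>
        ENNReal.ofReal |∫ x, v x * divergence φ x|) (testField v k)
      ⟨contDiff_testField hv k, hasCompactSupport_testField v k, norm_testField_le v k⟩)
    rw [integral_mul_divergence_eq_neg hv (contDiff_testField hv k)
      (hasCompactSupport_testField v k), abs_neg]
    exact ENNReal.ofReal_le_ofReal (le_abs_self _)
  calc ∫⁻ x, ‖gradient v x‖ₑ
      = ∫⁻ x, liminf (fun k => ENNReal.ofReal (inner ℝ (gradient v x) (testField v k x))) atTop := by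
        refine lintegral_congr fun x => ?_
        rw [← ofReal_norm]
        exact (ENNReal.tendsto_ofReal (tendsto_inner_testField v x)).liminf_eq.symm
    _ ≤ liminf (fun k => ∫⁻ x, ENNReal.ofReal (inner ℝ (gradient v x) (testField v k x))) atTop :=
        lintegral_liminf_le fun k => (hcont k).measurable.ennreal_ofReal
    _ ≤ _ := liminf_le_of_le (by isBoundedDefault) fun b hb => by
        obtain ⟨k, hk'⟩ := hb.exists
        exact hk'.trans (hk k)

lemma divergence_comp_add_right (φ : E N → E N) (t x : E N) :
    divergence (fun x => φ (x + t)) x = divergence φ (x + t) := by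
  unfold divergence
  refine Finset.sum_congr rfl fun i _ => ?_
  rw [fderiv_comp_add_right]

/-- Mollification does not increase the total variation, which is invariant under translations. -/
lemma totalVariation_mollify_le {u : E N → ℝ} (hu : LocallyIntegrable u) (n : ℕ) :
    totalVariation (mollify n u) ≤ totalVariation u := by
  refine iSup₂_le fun φ hφ => ?_
  obtain ⟨hφ, hc, hb⟩ := hφ
  rw [integral_mollify_mul n hu (continuous_divergence hφ) (hasCompactSupport_divergence hc),
    ← Real.enorm_eq_ofReal_abs]
  refine (enorm_integral_le_lintegral_enorm _).trans ?_
  calc _ ≤ ∫⁻ t, ENNReal.ofReal (mollifier N n t) * totalVariation u := by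
        refine lintegral_mono fun t => ?_
        rw [enorm_mul, Real.enorm_of_nonneg (mollifier_nonneg n t)]
        gcongr
        have h1 : ∫ x, u (x - t) * divergence φ x
            = ∫ x, u x * divergence (fun x => φ (x + t)) x := by
          rw [← integral_add_right_eq_self _ t]
          simp only [add_sub_cancel_right, divergence_comp_add_right]
        rw [h1, Real.enorm_eq_ofReal_abs]
        exact le_iSup₂ (f := fun (φ : E N → E N) (_ : φ ∈ {φ : E N → E N |
          ContDiff ℝ ∞ φ ∧ HasCompactSupport φ ∧ ∀ x, ‖φ x‖ ≤ 1}) =>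
            ENNReal.ofReal |∫ x, u x * divergence φ x|) (fun x => φ (x + t))
          ⟨hφ.comp (contDiff_id.add contDiff_const),
            hc.comp_homeomorph (Homeomorph.addRight t), fun x => hb (x + t)⟩
    _ = _ := by
        rw [lintegral_mul_const _ (by fun_prop), lintegral_mollifier, one_mul]

/-- A translation moves a smooth function in `L^1` by at most its directional variation. -/
lemma lintegral_translate_sub_le {v : E N → ℝ} (hv : ContDiff ℝ ∞ v) (h : E N) :
    ∫⁻ x, ‖v (x + h) - v x‖ₑ ≤ ∫⁻ x, ‖inner ℝ (gradient v x) h‖ₑ := by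
  have hc : Continuous fun x => fderiv ℝ v x h := continuous_fderiv_apply hv h
  have h1 : ∀ x, ‖v (x + h) - v x‖ₑ ≤ ∫⁻ t in Set.Ioc (0 : ℝ) 1, ‖fderiv ℝ v (x + t • h) h‖ₑ := by
    intro x
    have hd : ∀ t ∈ Set.uIcc (0 : ℝ) 1,
        HasDerivAt (fun t : ℝ => v (x + t • h)) (fderiv ℝ v (x + t • h) h) t := by
      intro t _
      have h2 : HasDerivAt (fun t : ℝ => x + t • h) h t := by
        simpa using ((hasDerivAt_id t).smul_const h).const_add x
      exact (hv.differentiable (by simp) _).hasFDerivAt.comp_hasDerivAt t h2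
    have h3 := intervalIntegral.integral_eq_sub_of_hasDerivAt hd
      ((hc.comp (by fun_prop : Continuous fun t : ℝ => x + t • h)).intervalIntegrable 0 1)
    simp only [one_smul, zero_smul, add_zero] at h3
    rw [← h3, intervalIntegral.integral_of_le zero_le_one]
    exact enorm_integral_le_lintegral_enorm _
  have hm : Measurable fun z : E N × ℝ => ‖fderiv ℝ v (z.1 + z.2 • h) h‖ₑ :=
    (hc.comp (by fun_prop : Continuous fun z : E N × ℝ => z.1 + z.2 • h)).measurable.enorm
  calc _ ≤ ∫⁻ x, ∫⁻ t in Set.Ioc (0 : ℝ) 1, ‖fderiv ℝ v (x + t • h) h‖ₑ := lintegral_mono h1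
    _ = ∫⁻ t in Set.Ioc (0 : ℝ) 1, ∫⁻ x, ‖fderiv ℝ v (x + t • h) h‖ₑ :=
        lintegral_lintegral_swap hm.aemeasurable
    _ = ∫⁻ t in Set.Ioc (0 : ℝ) 1, ∫⁻ x, ‖fderiv ℝ v x h‖ₑ := by
        refine lintegral_congr fun t => ?_
        exact lintegral_add_right_eq_self (fun x => ‖fderiv ℝ v x h‖ₑ) (t • h)
    _ = _ := by simp [inner_gradient_left]

end smoothVariation

/-! ### The upper bound for characteristic functions -/

section upperBound

variable {N : ℕ}

/-- Tonelli's theorem in the coordinates `(h, y)` with `x = y + h`. -/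
lemma lintegral_prod_translate {F : E N × E N → ℝ≥0∞} (hF : Measurable F) :
    ∫⁻ z, F z = ∫⁻ h, ∫⁻ y, F (y + h, y) := by
  rw [Measure.volume_eq_prod, lintegral_prod_symm _ hF.aemeasurable,
    lintegral_lintegral_swap (f := fun h y => F (y + h, y)) (by fun_prop)]
  refine lintegral_congr fun y => ?_
  rw [← lintegral_add_left_eq_self _ y]

/-- For a function with values in `{0, 1}`, the superlevel set at height `l` consists of pairs at
distance less than `l^{-1/(1+γ)}`, on which the difference of the values is `±1`. -/
lemma PhiL_indicator_le {Ω : Set (E N)} (hΩ : MeasurableSet Ω) {γ l : ℝ} (hγ : 0 < γ) (hl : 0 < l) :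
    PhiL 1 γ (Ω.indicator fun _ => (1 : ℝ)) l
      ≤ ENNReal.ofReal l * ∫⁻ h in Metric.ball 0 (l ^ (-(1 / (1 + γ)))), radialWeight N γ h *
        ∫⁻ y, ‖Ω.indicator (fun _ => (1 : ℝ)) (y + h) - Ω.indicator (fun _ => (1 : ℝ)) y‖ₑ := by
  set u : E N → ℝ := Ω.indicator fun _ => (1 : ℝ) with hu
  have hum : Measurable u := measurable_const.indicator hΩ
  set r := l ^ (-(1 / (1 + γ))) with hr
  have hr0 : 0 < r := Real.rpow_pos_of_pos hl _
  have hS : MeasurableSet (superlevel l (γ / 1) u) :=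
    measurableSet_lt measurable_const (measurable_diffQuot _ hum).abs
  have hsub : ∀ z ∈ superlevel l (γ / 1) u,
      z.1 - z.2 ∈ Metric.ball (0 : E N) r ∧ ‖u z.1 - u z.2‖ₑ = 1 := by
    intro z hz
    have hz' : l < |diffQuot (γ / 1) u z| := hz
    rw [diffQuot, div_one, abs_div] at hz'
    have hd : |u z.1 - u z.2| = 0 ∨ |u z.1 - u z.2| = 1 := by
      by_cases h1 : z.1 ∈ Ω <;> by_cases h2 : z.2 ∈ Ω <;> simp [hu, h1, h2]
    rcases hd with hd | hd
    · rw [hd, zero_div] at hz'; exact absurd hz' hl.not_gt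
    refine ⟨?_, by rw [Real.enorm_eq_ofReal_abs, hd, ENNReal.ofReal_one]⟩
    have h0 : 0 < ‖z.1 - z.2‖ := by
      rw [norm_pos_iff]
      intro h0
      rw [sub_eq_zero.1 h0, sub_self, abs_zero] at hd
      exact zero_ne_one hd
    rw [mem_ball_zero_iff]
    rw [hd, abs_of_pos (Real.rpow_pos_of_pos h0 _), lt_div_iff₀ (Real.rpow_pos_of_pos h0 _)] at hz'
    by_contra hcon
    rw [not_lt] at hcon
    have h3 : r ^ (1 + γ) ≤ ‖z.1 - z.2‖ ^ (1 + γ) := Real.rpow_le_rpow hr0.le hcon (by linarith)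
    have h4 : l * r ^ (1 + γ) = 1 := by
      rw [hr, ← Real.rpow_mul hl.le]
      have : -(1 / (1 + γ)) * (1 + γ) = -1 := by field_simp
      rw [this, Real.rpow_neg_one, mul_inv_cancel₀ hl.ne']
    nlinarith
  have hball : MeasurableSet (Metric.ball (0 : E N) r) := Metric.isOpen_ball.measurableSet
  have hF : Measurable fun z : E N × E N =>
      (Metric.ball (0 : E N) r).indicator (radialWeight N γ) (z.1 - z.2) * ‖u z.1 - u z.2‖ₑ :=
    (((measurable_radialWeight N γ).indicator hball).comp (by fun_prop)).mul (by fun_prop)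
  unfold PhiL
  rw [Real.rpow_one]
  gcongr
  have h1 : nu N γ (superlevel l (γ / 1) u)
      = ∫⁻ z in superlevel l (γ / 1) u, radialWeight N γ (z.1 - z.2) := withDensity_apply _ hS
  rw [h1, ← lintegral_indicator hS, ← lintegral_indicator hball]
  calc _ ≤ ∫⁻ z : E N × E N,
        (Metric.ball (0 : E N) r).indicator (radialWeight N γ) (z.1 - z.2) * ‖u z.1 - u z.2‖ₑ := by
        refine lintegral_mono fun z => ?_
        by_cases hz : z ∈ superlevel l (γ / 1) u
        · obtain ⟨h2, h3⟩ := hsub z hz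
          rw [Set.indicator_of_mem hz, Set.indicator_of_mem h2, h3, mul_one]
        · rw [Set.indicator_of_notMem hz]; exact zero_le
    _ = _ := by
        rw [lintegral_prod_translate hF]
        refine lintegral_congr fun h => ?_
        simp only [add_sub_cancel_left]
        rw [lintegral_const_mul _ (by fun_prop)]
        by_cases hh : h ∈ Metric.ball (0 : E N) r
        · rw [Set.indicator_of_mem hh, Set.indicator_of_mem hh]
        · rw [Set.indicator_of_notMem hh, Set.indicator_of_notMem hh, zero_mul]

lemma lintegral_radialWeight_translate_le_of_smooth (hN : 1 ≤ N) {e : E N} (he : ‖e‖ = 1) {γ r : ℝ}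
    (hγ : 0 < γ) (hr : 0 < r) {v : E N → ℝ} (hv : ContDiff ℝ ∞ v) :
    ∫⁻ h in Metric.ball 0 r, radialWeight N γ h * ∫⁻ y, ‖v (y + h) - v y‖ₑ
      ≤ ENNReal.ofReal (sphereConst N 1 e) * ENNReal.ofReal (r ^ (γ + 1) / (γ + 1)) *
        ∫⁻ y, ‖gradient v y‖ₑ := by
  have hg : Measurable (gradient v) := (contDiff_gradient hv).continuous.measurable
  calc _ ≤ ∫⁻ h in Metric.ball 0 r, ∫⁻ y,
          radialWeight N γ h * ‖inner ℝ (gradient v y) h‖ₑ := by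
        refine lintegral_mono fun h => ?_
        rw [lintegral_const_mul _ (by fun_prop)]
        exact mul_le_mul' le_rfl (lintegral_translate_sub_le hv h)
    _ = ∫⁻ y, ∫⁻ h in Metric.ball 0 r, radialWeight N γ h * ‖inner ℝ (gradient v y) h‖ₑ :=
        lintegral_lintegral_swap (by fun_prop)
    _ = ∫⁻ y, ENNReal.ofReal (sphereConst N 1 e) * ENNReal.ofReal (r ^ (γ + 1) / (γ + 1)) *
          ‖gradient v y‖ₑ := by
        refine lintegral_congr fun y => ?_
        have h1 := lintegral_inner_rpow_ball_eq hN one_pos (δ := γ + 1) (by linarith) hr he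
          (gradient v y)
        simp only [ENNReal.rpow_one, add_sub_cancel_right] at h1
        rw [← h1]
        simp only [mul_comm]
    _ = _ := lintegral_const_mul _ hg.enorm

/-- The weighted integral of `‖u(· + h) - u‖_1` over small `h` is bounded by the total variation, with
the sharp constant: this holds for the mollifications of `u`, and passes to the limit by Fatou's
lemma. -/
lemma lintegral_radialWeight_translate_le (hN : 1 ≤ N) {e : E N} (he : ‖e‖ = 1) {γ r : ℝ}
    (hγ : 0 < γ) (hr : 0 < r) {u : E N → ℝ} (hu : LocallyIntegrable u) :
    ∫⁻ h in Metric.ball 0 r, radialWeight N γ h * ∫⁻ y, ‖u (y + h) - u y‖ₑ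
      ≤ ENNReal.ofReal (sphereConst N 1 e) * ENNReal.ofReal (r ^ (γ + 1) / (γ + 1)) *
        totalVariation u := by
  have hvm : ∀ n, Measurable (mollify n u) := fun n => (mollify_continuous n hu).measurable
  have hae := ae_tendsto_mollify hu
  have h1 : ∀ h, ∫⁻ y, ‖u (y + h) - u y‖ₑ
      ≤ liminf (fun n => ∫⁻ y, ‖mollify n u (y + h) - mollify n u y‖ₑ) atTop := by
    intro h
    have hae' : ∀ᵐ y, Tendsto (fun n => mollify n u (y + h)) atTop (𝓝 (u (y + h))) :=
      (measurePreserving_add_right volume h).quasiMeasurePreserving.ae hae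
    calc _ = ∫⁻ y, liminf (fun n => ‖mollify n u (y + h) - mollify n u y‖ₑ) atTop := by
          refine lintegral_congr_ae ?_
          filter_upwards [hae, hae'] with y hy hy'
          exact ((continuous_enorm.tendsto _).comp (hy'.sub hy)).liminf_eq.symm
      _ ≤ _ := lintegral_liminf_le fun n => by have := hvm n; fun_prop
  have h2 : ∀ n, Measurable fun h => radialWeight N γ h *
      ∫⁻ y, ‖mollify n u (y + h) - mollify n u y‖ₑ := fun n =>
    (measurable_radialWeight N γ).mul (Measurable.lintegral_prod_right'
      (f := fun z : E N × E N => ‖mollify n u (z.2 + z.1) - mollify n u z.2‖ₑ)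
      (by have := hvm n; fun_prop))
  calc _ ≤ ∫⁻ h in Metric.ball 0 r, liminf (fun n => radialWeight N γ h *
          ∫⁻ y, ‖mollify n u (y + h) - mollify n u y‖ₑ) atTop := by
        refine lintegral_mono fun h => ?_
        refine (mul_le_mul' le_rfl (h1 h)).trans ?_
        have h3 := ENNReal.le_liminf_mul (f := atTop) (u := fun _ : ℕ => radialWeight N γ h)
          (v := fun n => ∫⁻ y, ‖mollify n u (y + h) - mollify n u y‖ₑ)
        rwa [liminf_const] at h3
    _ ≤ liminf (fun n => ∫⁻ h in Metric.ball 0 r, radialWeight N γ h *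
          ∫⁻ y, ‖mollify n u (y + h) - mollify n u y‖ₑ) atTop := lintegral_liminf_le h2
    _ ≤ _ := liminf_le_of_le (by isBoundedDefault) fun b hb => by
        obtain ⟨n, hn⟩ := hb.exists
        refine hn.trans ((lintegral_radialWeight_translate_le_of_smooth hN he hγ hr
          (mollify_contDiff n hu)).trans ?_)
        gcongr
        exact (lintegral_gradient_le_totalVariation (mollify_contDiff n hu)).trans
          (totalVariation_mollify_le hu n)

lemma mul_rpow_radius {γ l : ℝ} (hγ : 0 < γ) (hl : 0 < l) :
    l * (l ^ (-(1 / (1 + γ)))) ^ (γ + 1) = 1 := by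
  rw [← Real.rpow_mul hl.le]
  have : -(1 / (1 + γ)) * (γ + 1) = -1 := by field_simp; ring
  rw [this, Real.rpow_neg_one, mul_inv_cancel₀ hl.ne']

lemma PhiL_indicator_le_totalVariation (hN : 1 ≤ N) {e : E N} (he : ‖e‖ = 1) {Ω : Set (E N)}
    (hΩ : MeasurableSet Ω) {γ l : ℝ} (hγ : 0 < γ) (hl : 0 < l) :
    PhiL 1 γ (Ω.indicator fun _ => (1 : ℝ)) l ≤ ENNReal.ofReal (sphereConst N 1 e / (γ + 1)) *
      totalVariation (Ω.indicator fun _ => (1 : ℝ)) := by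
  have hloc : LocallyIntegrable (Ω.indicator fun _ => (1 : ℝ)) :=
    locallyIntegrable_of_bounded (measurable_const.indicator hΩ) (M := 1) fun x => by
      by_cases hx : x ∈ Ω <;> simp [hx]
  refine (PhiL_indicator_le hΩ hγ hl).trans ((mul_le_mul' le_rfl
    (lintegral_radialWeight_translate_le hN he hγ (Real.rpow_pos_of_pos hl _) hloc)).trans ?_)
  rw [← mul_assoc, ← ENNReal.ofReal_mul (sphereConst_nonneg _ _ _), ← ENNReal.ofReal_mul hl.le]
  gcongr
  refine le_of_eq ?_
  have h1 := mul_rpow_radius hγ hl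
  calc l * (sphereConst N 1 e * ((l ^ (-(1 / (1 + γ)))) ^ (γ + 1) / (γ + 1)))
      = sphereConst N 1 e * (l * (l ^ (-(1 / (1 + γ)))) ^ (γ + 1)) / (γ + 1) := by ring
    _ = _ := by rw [h1, mul_one]

end upperBound

/-! ### Bounded convex sets -/

section convexSets

variable {N : ℕ}

/-- A homothetic copy of a convex set containing the ball `B(c, ρ)`, with centre `c` and ratio
`1 - t`, can be translated by any vector shorter than `t ρ` without leaving the set. -/
lemma homothety_add_mem {Ω : Set (E N)} (hconv : Convex ℝ Ω) {c : E N} {ρ : ℝ}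
    (hball : Metric.ball c ρ ⊆ Ω) {t : ℝ} (ht0 : 0 < t) (ht1 : t < 1) {h : E N} (hh : ‖h‖ < t * ρ)
    {x : E N} (hx : x ∈ AffineMap.homothety c (1 - t) '' Ω) : x + h ∈ Ω := by
  obtain ⟨y, hy, rfl⟩ := hx
  have h1 : c + t⁻¹ • h ∈ Ω := by
    apply hball
    rw [Metric.mem_ball, dist_eq_norm, add_sub_cancel_left, norm_smul, norm_inv,
      Real.norm_of_nonneg ht0.le, inv_mul_lt_iff₀ ht0]
    exact hh
  have h2 := hconv hy h1 (by linarith : 0 ≤ 1 - t) ht0.le (by ring)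
  convert h2 using 1
  rw [AffineMap.homothety_apply, vsub_eq_sub, vadd_eq_add, smul_add, smul_smul,
    mul_inv_cancel₀ ht0.ne', one_smul, smul_sub, sub_smul, sub_smul, one_smul, one_smul]
  abel

lemma volume_diff_translate_le {Ω : Set (E N)} (hopen : IsOpen Ω) (hconv : Convex ℝ Ω)
    (hbdd : Bornology.IsBounded Ω) {c : E N} {ρ : ℝ} (hρ : 0 < ρ) (hball : Metric.ball c ρ ⊆ Ω)
    {t : ℝ} (ht0 : 0 < t) (ht1 : t < 1) {h : E N} (hh : ‖h‖ < t * ρ) :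
    volume {x | x ∈ Ω ∧ x + h ∉ Ω} ≤ ENNReal.ofReal (N * t) * volume Ω := by
  set H := AffineMap.homothety c (1 - t) '' Ω with hH
  have hsub : H ⊆ Ω := fun x hx => by
    simpa using homothety_add_mem hconv hball ht0 ht1 (h := 0) (by simpa using by positivity) hx
  have hfin : volume Ω ≠ ⊤ := hbdd.measure_lt_top.ne
  have hHv : volume H = ENNReal.ofReal ((1 - t) ^ N) * volume Ω := by
    have := Measure.addHaar_image_homothety (volume : Measure (E N)) c (1 - t) Ω
    rw [hH, this, finrank_euclideanSpace_fin, abs_of_nonneg (pow_nonneg (by linarith) _)]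
  have hHm : MeasurableSet H := by
    have h1 : IsOpen H := by
      rw [hH]
      exact AffineMap.homothety_isOpenMap c (1 - t) (by linarith) _ hopen
    exact h1.measurableSet
  calc volume {x | x ∈ Ω ∧ x + h ∉ Ω} ≤ volume (Ω \ H) := by
        refine measure_mono fun x hx => ⟨hx.1, fun hxH => hx.2 ?_⟩
        exact homothety_add_mem hconv hball ht0 ht1 hh hxH
    _ = volume Ω - ENNReal.ofReal ((1 - t) ^ N) * volume Ω := by
        rw [measure_sdiff hsub hHm.nullMeasurableSet (measure_ne_top_of_subset hsub hfin), hHv]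
    _ ≤ _ := by
        rw [tsub_le_iff_right, ← add_mul]
        have h1 : (1 : ℝ≥0∞) ≤ ENNReal.ofReal (N * t) + ENNReal.ofReal ((1 - t) ^ N) := by
          rw [← ENNReal.ofReal_add (by positivity) (pow_nonneg (by linarith) _),
            ← ENNReal.ofReal_one]
          apply ENNReal.ofReal_le_ofReal
          have := one_add_mul_le_pow (a := -t) (by linarith) N
          rw [← sub_eq_add_neg] at this
          linarith
        calc volume Ω = 1 * volume Ω := (one_mul _).symm
          _ ≤ _ := by gcongr

/-- The characteristic function of a bounded convex open set is Lipschitz in `L^1` under small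
translations. -/
lemma exists_lintegral_indicator_translate_le {Ω : Set (E N)} (hopen : IsOpen Ω)
    (hne : Ω.Nonempty) (hconv : Convex ℝ Ω) (hbdd : Bornology.IsBounded Ω) :
    ∃ r₀ : ℝ, 0 < r₀ ∧ ∃ A : ℝ≥0∞, A ≠ ⊤ ∧ ∀ h : E N, ‖h‖ < r₀ →
      ∫⁻ y, ‖Ω.indicator (fun _ => (1 : ℝ)) (y + h) - Ω.indicator (fun _ => (1 : ℝ)) y‖ₑ
        ≤ A * ‖h‖ₑ := by
  obtain ⟨c, hc⟩ := hne
  obtain ⟨ρ, hρ, hball⟩ := Metric.isOpen_iff.1 hopen c hc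
  have hfin : volume Ω ≠ ⊤ := hbdd.measure_lt_top.ne
  refine ⟨ρ / 2, by positivity, ENNReal.ofReal (4 * N / ρ) * volume Ω,
    ENNReal.mul_ne_top ENNReal.ofReal_ne_top hfin, fun h hh => ?_⟩
  by_cases h0 : h = 0
  · simp [h0]
  have hn : 0 < ‖h‖ := norm_pos_iff.2 h0
  -- Any ratio between `‖h‖ / ρ` and `1` is admissible.
  set t := 2 * ‖h‖ / ρ with ht
  have ht0 : 0 < t := by positivity
  have ht1 : t < 1 := by rw [ht, div_lt_one hρ]; linarith
  have htρ : ‖h‖ < t * ρ := by rw [ht, div_mul_cancel₀ _ hρ.ne']; linarith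
  set S : E N → Set (E N) := fun h => {x | x ∈ Ω ∧ x + h ∉ Ω} with hS
  have hSm : ∀ h, MeasurableSet (S h) := fun h =>
    hopen.measurableSet.inter ((measurable_add_const h) hopen.measurableSet).compl
  have h1 : ∀ y, ‖Ω.indicator (fun _ => (1 : ℝ)) (y + h) - Ω.indicator (fun _ => (1 : ℝ)) y‖ₑ
      ≤ (S h).indicator (fun _ => (1 : ℝ≥0∞)) y + (S (-h)).indicator (fun _ => 1) (y + h) := by
    intro y
    by_cases hy : y ∈ Ω <;> by_cases hyh : y + h ∈ Ω
    · simp [hy, hyh]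
    · have : y ∈ S h := ⟨hy, hyh⟩
      rw [Set.indicator_of_mem this]
      simp [hy, hyh]
    · have : y + h ∈ S (-h) := ⟨hyh, by simpa using hy⟩
      rw [Set.indicator_of_mem this]
      simp [hy, hyh]
    · simp [hy, hyh]
  calc _ ≤ ∫⁻ y, ((S h).indicator (fun _ => (1 : ℝ≥0∞)) y
          + (S (-h)).indicator (fun _ => 1) (y + h)) := lintegral_mono h1
    _ = volume (S h) + volume (S (-h)) := by
        rw [lintegral_add_left (measurable_const.indicator (hSm h)),
          lintegral_add_right_eq_self (fun y => (S (-h)).indicator (fun _ => (1 : ℝ≥0∞)) y) h]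
        simp [hSm]
    _ ≤ ENNReal.ofReal (N * t) * volume Ω + ENNReal.ofReal (N * t) * volume Ω :=
        add_le_add (volume_diff_translate_le hopen hconv hbdd hρ hball ht0 ht1 htρ)
          (volume_diff_translate_le hopen hconv hbdd hρ hball ht0 ht1 (by rwa [norm_neg]))
    _ = _ := by
        rw [← add_mul, ← ENNReal.ofReal_add (by positivity) (by positivity), mul_right_comm,
          ← ofReal_norm, ← ENNReal.ofReal_mul (by positivity)]
        congr 2
        rw [ht]; field_simp; ring

/-- The total variation is finite because `Φ_λ` stays bounded and controls it. -/
lemma totalVariation_indicator_lt_top (hN : 1 ≤ N) {e : E N} (he : ‖e‖ = 1) {Ω : Set (E N)}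
    (hopen : IsOpen Ω) (hne : Ω.Nonempty) (hconv : Convex ℝ Ω) (hbdd : Bornology.IsBounded Ω) :
    Phi 1 (Ω.indicator fun _ => (1 : ℝ)) < ⊤ := by
  have hloc : LocallyIntegrable (Ω.indicator fun _ => (1 : ℝ)) :=
    locallyIntegrable_of_bounded (measurable_const.indicator hopen.measurableSet) (M := 1)
      fun x => by by_cases hx : x ∈ Ω <;> simp [hx]
  -- The value `γ = 1` is an arbitrary choice.
  refine Phi_lt_top hN he hloc le_rfl (γ := 1) one_pos ?_
  obtain ⟨r₀, hr₀, A, hA, hle⟩ := exists_lintegral_indicator_translate_le hopen hne hconv hbdd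
  have hlim : Tendsto (fun l : ℝ => l ^ (-(1 / (1 + 1) : ℝ))) atTop (𝓝 0) :=
    tendsto_rpow_neg_atTop (by norm_num)
  refine (limsup_le_of_le (a := A * ENNReal.ofReal (sphereConst N 0 e / 2)) (by isBoundedDefault)
    ?_).trans_lt (ENNReal.mul_lt_top hA.lt_top ENNReal.ofReal_lt_top)
  filter_upwards [hlim.eventually (gt_mem_nhds hr₀), eventually_gt_atTop 0] with l hl hl0
  refine (PhiL_indicator_le hopen.measurableSet one_pos hl0).trans ?_
  set r := l ^ (-(1 / (1 + 1) : ℝ)) with hr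
  have hr0 : 0 < r := Real.rpow_pos_of_pos hl0 _
  have hw : ∀ h : E N, radialWeight N 1 h * ‖h‖ₑ ≤ radialWeight N 2 h := by
    intro h
    by_cases h0 : h = 0
    · simp [h0]
    have hn : 0 < ‖h‖ := norm_pos_iff.2 h0
    rw [radialWeight, radialWeight, ← ofReal_norm, ← ENNReal.ofReal_mul (by positivity),
      ← Real.rpow_add_one hn.ne']
    refine le_of_eq ?_
    congr 2; ring
  calc _ ≤ ENNReal.ofReal l * ∫⁻ h in Metric.ball (0 : E N) r, A * radialWeight N 2 h := by
        refine mul_le_mul' le_rfl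
          (setLIntegral_mono' Metric.isOpen_ball.measurableSet fun h hh => ?_)
        have h1 := hle h ((mem_ball_zero_iff.1 hh).trans hl)
        calc _ ≤ radialWeight N 1 h * (A * ‖h‖ₑ) := mul_le_mul' le_rfl h1
          _ = A * (radialWeight N 1 h * ‖h‖ₑ) := by ring
          _ ≤ _ := mul_le_mul' le_rfl (hw h)
    _ = A * (ENNReal.ofReal l * ENNReal.ofReal (sphereConst N 0 e * (r ^ (2 : ℝ) / 2))) := by
        rw [lintegral_const_mul _ (by fun_prop), lintegral_radialWeight_ball hN two_pos hr0 e]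
        ring
    _ = A * ENNReal.ofReal (sphereConst N 0 e / 2) := by
        rw [← ENNReal.ofReal_mul hl0.le]
        congr 2
        have h1 := mul_rpow_radius one_pos hl0
        rw [← hr, show (1 : ℝ) + 1 = 2 by norm_num] at h1
        calc _ = sphereConst N 0 e * (l * r ^ (2 : ℝ)) / 2 := by ring
          _ = _ := by rw [h1, mul_one]

/-- The total variation is positive: near the set, the position vector field is a multiple of an
admissible test field and has constant divergence. -/
lemma totalVariation_indicator_pos (hN : 1 ≤ N) {Ω : Set (E N)} (hopen : IsOpen Ω)
    (hne : Ω.Nonempty) (hbdd : Bornology.IsBounded Ω) :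
    0 < totalVariation (Ω.indicator fun _ => (1 : ℝ)) := by
  obtain ⟨R, hR, hΩ⟩ := hbdd.subset_ball_lt 0 (0 : E N)
  let χ : ContDiffBump (0 : E N) := ⟨R, R + 1, hR, by linarith⟩
  set a : ℝ := (R + 1)⁻¹ with ha
  have ha0 : 0 < a := by positivity
  set φ : E N → E N := fun x => (a * χ x) • x with hφ
  have hφs : ContDiff ℝ ∞ φ := (contDiff_const.mul χ.contDiff).smul contDiff_id
  have hφc : HasCompactSupport φ :=
    HasCompactSupport.smul_right (f := fun x => a * χ x) χ.hasCompactSupport.mul_left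
  have hφb : ∀ x, ‖φ x‖ ≤ 1 := by
    intro x
    rw [hφ]
    simp only
    rw [norm_smul, Real.norm_of_nonneg (mul_nonneg ha0.le χ.nonneg)]
    by_cases hx : ‖x‖ ≤ R + 1
    · calc a * χ x * ‖x‖ ≤ a * 1 * (R + 1) := by
            gcongr
            exact χ.le_one
        _ = 1 := by rw [ha]; field_simp
    · rw [χ.zero_of_le_dist (by simpa using (not_le.1 hx).le)]; simp
  have hdiv : ∀ x ∈ Ω, divergence φ x = N * a := by
    intro x hx
    have h1 : φ =ᶠ[𝓝 x] fun y => a • y := by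
      filter_upwards [Metric.isOpen_ball.mem_nhds (hΩ hx)] with y hy
      simp only [hφ]
      rw [χ.one_of_mem_closedBall (Metric.ball_subset_closedBall hy), mul_one]
    have h2 : fderiv ℝ φ x = a • ContinuousLinearMap.id ℝ (E N) := by
      rw [h1.fderiv_eq]
      exact ((hasFDerivAt_id x).const_smul a).fderiv
    unfold divergence
    simp [h2]
  have hint : ∫ x, Ω.indicator (fun _ => (1 : ℝ)) x * divergence φ x = N * a * volume.real Ω := by
    have h1 : (fun x => Ω.indicator (fun _ => (1 : ℝ)) x * divergence φ x)
        = Ω.indicator fun _ => (N * a : ℝ) := by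
      ext x
      by_cases hx : x ∈ Ω
      · simp [hx, hdiv x hx]
      · simp [hx]
    rw [h1, integral_indicator_const _ hopen.measurableSet, smul_eq_mul, mul_comm]
  have hpos : 0 < ENNReal.ofReal |∫ x, Ω.indicator (fun _ => (1 : ℝ)) x * divergence φ x| := by
    rw [ENNReal.ofReal_pos, abs_pos, hint]
    have h1 : 0 < volume.real Ω :=
      ENNReal.toReal_pos (hopen.measure_pos volume hne).ne' hbdd.measure_lt_top.ne
    have h2 : (0 : ℝ) < N := by exact_mod_cast hN
    positivity
  exact hpos.trans_le (le_iSup₂ (f := fun (φ : E N → E N) (_ : φ ∈ {φ : E N → E N |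
    ContDiff ℝ ∞ φ ∧ HasCompactSupport φ ∧ ∀ x, ‖φ x‖ ≤ 1}) =>
      ENNReal.ofReal |∫ x, Ω.indicator (fun _ => (1 : ℝ)) x * divergence φ x|) φ ⟨hφs, hφc, hφb⟩)

end convexSets

lemma Phi_one {N : ℕ} (u : E N → ℝ) : Phi 1 u = totalVariation u := if_pos rfl

end NonlocalBV

end

theorem mainTheorem3 (N : ℕ) (hN : 1 ≤ N) (γ : ℝ) (hγ : 0 < γ)
    (e : NonlocalBV.E N) (he : ‖e‖ = 1) :
    (∀ p : ℝ, 1 ≤ p → ∀ u : NonlocalBV.E N → ℝ, LocallyIntegrable u volume →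
      ENNReal.ofReal (NonlocalBV.sphereConst N p e / (γ + p)) * NonlocalBV.Phi p u
          ≤ limsup (fun l : ℝ => NonlocalBV.PhiL p γ u l) atTop ∧
      (MemLp u (ENNReal.ofReal p) volume →
        limsup (fun l : ℝ => NonlocalBV.PhiL p γ u l) atTop < ⊤ →
          (1 < p → NonlocalBV.MemSobolev p u) ∧ (p = 1 → NonlocalBV.MemBV u))) ∧
    (∀ Ω : Set (NonlocalBV.E N), IsOpen Ω → Ω.Nonempty → Convex ℝ Ω → Bornology.IsBounded Ω →
      NonlocalBV.HasSmoothBoundary Ω →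
        0 < NonlocalBV.Phi 1 (Ω.indicator fun _ => (1 : ℝ)) ∧
        NonlocalBV.Phi 1 (Ω.indicator fun _ => (1 : ℝ)) < ⊤ ∧
        ENNReal.ofReal (NonlocalBV.sphereConst N 1 e / (γ + 1)) *
            NonlocalBV.Phi 1 (Ω.indicator fun _ => (1 : ℝ))
          = limsup (fun l : ℝ => NonlocalBV.PhiL 1 γ (Ω.indicator fun _ => (1 : ℝ)) l) atTop) := by
  refine ⟨fun p hp u hu => ⟨NonlocalBV.mul_Phi_le_limsup hN he hu hp hγ, fun hup hlim => ?_⟩,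
    fun Ω hopen hne hconv hbdd _ => ⟨?_, ?_, le_antisymm ?_ ?_⟩⟩
  · have hPhi := NonlocalBV.Phi_lt_top hN he hu hp hγ hlim
    refine ⟨fun hp1 => NonlocalBV.memSobolev_of_Phi_lt_top hp1 hup hPhi, fun hp1 => ?_⟩
    subst hp1
    rw [NonlocalBV.Phi_one] at hPhi
    exact ⟨by simpa using hup, hPhi⟩
  · rw [NonlocalBV.Phi_one]
    exact NonlocalBV.totalVariation_indicator_pos hN hopen hne hbdd
  · exact NonlocalBV.totalVariation_indicator_lt_top hN he hopen hne hconv hbdd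
  · refine NonlocalBV.mul_Phi_le_limsup hN he ?_ le_rfl hγ
    refine NonlocalBV.locallyIntegrable_of_bounded
      (measurable_const.indicator hopen.measurableSet) (M := 1) fun x => ?_
    by_cases hx : x ∈ Ω <;> simp [hx]
  · rw [NonlocalBV.Phi_one]
    refine limsup_le_of_le (by isBoundedDefault) ?_
    filter_upwards [eventually_gt_atTop 0] with l hl
    exact NonlocalBV.PhiL_indicator_le_totalVariation hN he hopen.measurableSet hγ hl
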